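/- A rooted graph is a finite simple graph $G$ together with a set $R\subseteq V(G)$ of roots. It has a rooted $K_{2,t}$ minor if there are pairwise disjoint vertex sets $X_1,X_2,Y_1,\dots,Y_t\subseteq V(G)$, each inducing a (non-empty) connected subgraph of $G$, such that $G$ has an edge between $X_i$ and $Y_j$ for all $i\in\{1,2\}$ and $j\in\{1,\dots,t\}$, and each $Y_j$ contains a root. If $G$ is embedded in the plane, the faces are the connected components of the complement of $G$ in the plane, a vertex is incident to the faces on whose boundary it lies, and a face cover is a collection of faces such that every root is incident to at least one face of the collection. For even $t\ge 6$, let $p=t/2$ and $q=\lfloor t/5\rfloor$. The windmill $W_t$ is the following rooted graph. Start with a cycle $u_1v_1u_2v_2\cdots u_pv_pu_1$ and a vertex $z$ adjacent to every vertex of the cycle. For each $i\in\{1,\dots,p\}$, add three paths $a_{i,1}\cdots a_{i,2q}$, $b_{i,1}\cdots b_{i,2q}$, $c_{i,1}\cdots c_{i,2q}$ with $a_{i,1}=u_i$, $b_{i,1}=v_i$, $c_{i,1}=u_{i+1}$ (where $u_{p+1}=u_1$) and all other vertices new and distinct, the edges $a_{i,j}b_{i,j}$ and $b_{i,j}c_{i,j}$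 for $2\le j\le 2q$, and the edge $a_{i,2q}c_{i,2q}$. The roots are the vertices $b_{i,j}$ with $1\le i\le p$ and $j\in\{1,\dots,2q\}$ odd. **Proposition.** 1. For every even $t\ge 6$, the graph $W_t$ is $3$-connected and planar, and the rooted graph $W_t$ has no rooted $K_{2,t}$ minor. 2. There is a constant $c>0$ such that for every even $t\ge 6$ and every embedding of $W_t$ in the plane, every face cover of $W_t$ has size at least $c\,t^2$. 3. Consequently, let $f:\mathbb{Z}_{\ge1}\to\mathbb{Z}_{\ge0}$ be any function such that, for every $t\ge1$, every $3$-connected rooted graph embedded in the plane without a rooted $K_{2,t}$ minor has a face cover of size at most $f(t)$. Then $f(t)=\Omega(t^2)$; more precisely, there is a constant $c>0$ such that $f(t)\ge c\,t^2$ for all $t\ge 6$. -/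

import Mathlib

/-! ### Connectivity and rooted minors -/

/-- `G` is `k`-connected: it has more than `k` vertices, and deleting fewer than `k` vertices
always leaves a connected graph. -/
def SimpleGraph.IsVertexConnected {V : Type*} (G : SimpleGraph V) (k : ℕ) : Prop :=
  k < Nat.card V ∧ ∀ X : Finset V, X.card < k → (G.induce (X : Set V)ᶜ).Connected

/-- `M` assigns to the vertices of `H` the branch sets of an `H`-model in `G`: each branch set is
connected (in particular non-empty), branch sets of distinct vertices are disjoint, and for every
edge `uv` of `H` some edge of `G` joins the branch sets of `u` and `v`. -/
structure IsGraphModel {W V : Type*} (H : SimpleGraph W) (G : SimpleGraph V)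
    (M : W → Set V) : Prop where
  connected : ∀ w, (G.induce (M w)).Connected
  disjoint : ∀ u v, u ≠ v → Disjoint (M u) (M v)
  edge : ∀ u v, H.Adj u v → ∃ x ∈ M u, ∃ y ∈ M v, G.Adj x y

/-- The rooted graph `(G, R)` has a rooted `K_{2,t}` minor: there is a `K_{2,t}`-model in `G` whose
`t` branch sets on the second side each contain a root. -/
def HasRootedK2Minor {V : Type*} (G : SimpleGraph V) (R : Set V) (t : ℕ) : Prop :=
  ∃ M : Fin 2 ⊕ Fin t → Set V,
    IsGraphModel (completeBipartiteGraph (Fin 2) (Fin t)) G M ∧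
      ∀ j : Fin t, ∃ r ∈ R, r ∈ M (Sum.inr j)

/-! ### Plane graphs, faces and face covers -/

/-- The Euclidean plane. -/
abbrev Plane : Type := EuclideanSpace ℝ (Fin 2)

/-- An embedding of the graph `G` in the plane: the vertices are distinct points, every edge is a
simple arc joining its two ends, an edge contains no vertex other than its ends, and two distinct
edges meet only in common ends. -/
structure PlaneEmbedding {V : Type*} (G : SimpleGraph V) where
  point : V → Plane
  arc : G.edgeSet → Set Plane
  point_injective : Function.Injective point
  isArc : ∀ (u v : V) (h : s(u, v) ∈ G.edgeSet), ∃ γ : Path (point u) (point v),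
    Function.Injective γ ∧ Set.range γ = arc ⟨s(u, v), h⟩
  mem_of_point_mem : ∀ (e : G.edgeSet) (w : V), point w ∈ arc e → w ∈ (e : Sym2 V)
  arc_inter : ∀ e e' : G.edgeSet, e ≠ e' → ∀ x ∈ arc e ∩ arc e',
    ∃ w : V, w ∈ (e : Sym2 V) ∧ w ∈ (e' : Sym2 V) ∧ x = point w

namespace PlaneEmbedding

variable {V : Type*} {G : SimpleGraph V}

/-- The subset of the plane formed by all vertices and edges of the embedded graph. -/
def carrier (E : PlaneEmbedding G) : Set Plane :=
  Set.range E.point ∪ ⋃ e, E.arc e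

/-- The faces of the embedded graph: the connected components of the complement of the graph. -/
def IsFace (E : PlaneEmbedding G) (F : Set Plane) : Prop :=
  ∃ x ∈ E.carrierᶜ, F = connectedComponentIn E.carrierᶜ x

/-- The vertex `v` is incident to the face `F`: it lies on the boundary of `F`. -/
def IsIncident (E : PlaneEmbedding G) (v : V) (F : Set Plane) : Prop :=
  E.point v ∈ frontier F

/-- `C` is a face cover of the plane rooted graph with root set `R`: a collection of faces such that
every root is incident to some face of the collection. -/
def IsFaceCover (E : PlaneEmbedding G) (R : Set V) (C : Finset (Set Plane)) : Prop :=
  (∀ F ∈ C, E.IsFace F) ∧ ∀ r ∈ R, ∃ F ∈ C, E.IsIncident r F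

end PlaneEmbedding

/-! ### The windmill -/

/-- The vertices of the windmill with `p` vanes of length `2 * q`: the centre `z`, the vertices
`u i`, `v i` of the initial cycle, and the further vertices `a i j`, `b i j`, `c i j` with
`2 ≤ j ≤ 2 * q` of the three paths of the `i`-th vane. -/
inductive WindmillVertex (p q : ℕ) : Type
  | z
  | u (i : Fin p)
  | v (i : Fin p)
  | a (i : Fin p) (j : Set.Icc 2 (2 * q))
  | b (i : Fin p) (j : Set.Icc 2 (2 * q))
  | c (i : Fin p) (j : Set.Icc 2 (2 * q))

namespace WindmillVertex

variable {p q : ℕ}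

/-- The `j`-th vertex of the first path of the `i`-th vane, `1 ≤ j ≤ 2 * q`; it starts at `u i`. -/
def pathA (i : Fin p) (j : Set.Icc 1 (2 * q)) : WindmillVertex p q :=
  if h : 2 ≤ (j : ℕ) then a i ⟨j, h, j.2.2⟩ else u i

/-- The `j`-th vertex of the second path of the `i`-th vane, `1 ≤ j ≤ 2 * q`; it starts at `v i`. -/
def pathB (i : Fin p) (j : Set.Icc 1 (2 * q)) : WindmillVertex p q :=
  if h : 2 ≤ (j : ℕ) then b i ⟨j, h, j.2.2⟩ else v i

/-- The `j`-th vertex of the third path of the `i`-th vane, `1 ≤ j ≤ 2 * q`; it starts at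
`u (i + 1)`, with the index `i + 1` computed cyclically. -/
def pathC (i : Fin p) (j : Set.Icc 1 (2 * q)) : WindmillVertex p q :=
  if h : 2 ≤ (j : ℕ) then c i ⟨j, h, j.2.2⟩ else u (finRotate p i)

/-- The edges of the windmill, each listed in one orientation. -/
def Edge (x y : WindmillVertex p q) : Prop :=
  -- the cycle `u_1 v_1 u_2 v_2 ... u_p v_p u_1`
  (∃ i, x = u i ∧ y = v i) ∨ (∃ i, x = v i ∧ y = u (finRotate p i)) ∨
  -- the centre is adjacent to every vertex of the cycle
  (∃ i, x = z ∧ y = u i) ∨ (∃ i, x = z ∧ y = v i) ∨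
  -- the three paths of each vane
  (∃ (i : Fin p) (j k : Set.Icc 1 (2 * q)), (k : ℕ) = j + 1 ∧
    ((x = pathA i j ∧ y = pathA i k) ∨ (x = pathB i j ∧ y = pathB i k) ∨
      (x = pathC i j ∧ y = pathC i k))) ∨
  -- the rungs of each vane
  (∃ (i : Fin p) (j : Set.Icc 1 (2 * q)), 2 ≤ (j : ℕ) ∧
    ((x = pathA i j ∧ y = pathB i j) ∨ (x = pathB i j ∧ y = pathC i j))) ∨
  -- the edge joining the ends of the outer two paths of each vane
  (∃ (i : Fin p) (j : Set.Icc 1 (2 * q)), (j : ℕ) = 2 * q ∧ x = pathA i j ∧ y = pathC i j)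

end WindmillVertex

/-- The windmill of parameter `t`, with `t / 2` vanes of length `2 * ⌊t / 5⌋`. -/
def windmill (t : ℕ) : SimpleGraph (WindmillVertex (t / 2) (t / 5)) :=
  SimpleGraph.fromRel WindmillVertex.Edge

/-- The roots of the windmill of parameter `t`: the vertices `b_{i,j}` with `j` odd. -/
def windmillRoots (t : ℕ) : Set (WindmillVertex (t / 2) (t / 5)) :=
  {x | ∃ (i : Fin (t / 2)) (j : Set.Icc 1 (2 * (t / 5))), Odd (j : ℕ) ∧
    x = WindmillVertex.pathB i j}

/-!
*Minors.* In a rooted `K_{2,t}` model, one of the two large branch sets, say `X'`, misses the hub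
`z`; let `X` be the other one. If `X'` joins the two ends `u_i`, `u_{i+1}` of a vane inside it, then
`X'` climbs along both outer paths and encloses a stretch of `b_{i,1} b_{i,2} ⋯`; at most one `Y_j`
rooted in this vane can reach `X` from there, and none can unless `z ∈ X`. The vanes that `X'`
crosses in this way are the edges of a connected graph on the `u_k` in `X'`, so their number is at
least the number of these `u_k` minus one. Hence at most two vanes have an end in `X'` without being
crossed, and they hold at most `2q` roots. In a vane without ends in `X'`, each `Y_j` rooted there
contains `z` or, to reach `X'`, some `u_k` outside `X'`. Altogether `t ≤ p + 2q < 2p`. If a large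
branch set lies inside one vane, then all but three of the `Y_j` are rooted in that vane, and
`t ≤ q + 3 < 2p`.

*Faces.* For `m ≥ 2`, the three vertices `b_{i,m}`, `b_{i,m+2}` and any root `y` that lies below row
`m` or in another vane are connected to `a_{i,m}`, `c_{i,m}` and `b_{i,m+1}` by the paths of a
subdivided `K_{3,3}`, except that the path from `y` to `b_{i,m+1}` is missing. If `y` and
`b_{i,m+1}` were incident to the same face, this path could be drawn inside it. So the `p (q - 1)`
roots in rows `3, 5, …, 2q - 1` are incident to pairwise distinct faces. That `K_{3,3}` is not
planar follows by parity: the difference `γ(s) - δ(t)` between two disjoint edges never vanishes, so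
the increments of its logarithm around the boundary of the parameter square sum to zero, and adding
up these relations over all pairs of disjoint edges gives a contradiction modulo 2.
-/

/-! ### Non-planarity of `K_{3,3}` -/

section LogIncrement

open Complex

/-- `d` is the total increment, from time `0` to time `1`, of a continuous branch of the logarithm
along the nowhere vanishing curve `f`. It replaces the winding number for curves that need not be
closed. -/
def IsLogIncrement (f : ℝ → ℂ) (d : ℂ) : Prop :=
  ∃ l : ℝ → ℂ, Continuous l ∧ (∀ t, exp (l t) = f t) ∧ l 1 - l 0 = d

theorem exists_continuous_exp_eq {A : Type*} [TopologicalSpace A] [SimplyConnectedSpace A]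
    [LocallyPathConnectedSpace A] {f : A → ℂ} (hf : Continuous f) (h0 : ∀ a, f a ≠ 0) :
    ∃ l : A → ℂ, Continuous l ∧ ∀ a, exp (l a) = f a := by
  obtain ⟨a₀⟩ : Nonempty A := inferInstance
  obtain ⟨F, ⟨-, hF⟩, -⟩ := isCoveringMapOn_exp.existsUnique_continuousMap_lifts
    ⟨f, hf⟩ (a₀ := a₀) (exp_log (h0 a₀)) (fun a => h0 a)
  exact ⟨F, F.continuous, fun a => congrFun hF a⟩

theorem IsLogIncrement.unique {f : ℝ → ℂ} {d d' : ℂ} (h : IsLogIncrement f d)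
    (h' : IsLogIncrement f d') : d = d' := by
  obtain ⟨l, hl, hlf, rfl⟩ := h
  obtain ⟨m, hm, hmf, rfl⟩ := h'
  obtain ⟨n, hn⟩ := exp_eq_exp_iff_exists_int.1 ((hlf 0).trans (hmf 0).symm)
  have hshift : ∀ t, exp (m t + n * (2 * Real.pi * I)) = f t := fun t => by
    rw [exp_add, exp_int_mul_two_pi_mul_I, mul_one, hmf]
  have hlm : l = fun t => m t + n * (2 * Real.pi * I) :=
    isCoveringMap_exp.eq_of_comp_eq hl (by fun_prop)
      (funext fun t => Subtype.ext ((hlf t).trans (hshift t).symm)) 0 hn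
  simp only [hlm, add_sub_add_right_eq_sub]

theorem IsLogIncrement.neg {f : ℝ → ℂ} {d : ℂ} (h : IsLogIncrement f d) :
    IsLogIncrement (fun t => -f t) d := by
  obtain ⟨l, hl, hlf, rfl⟩ := h
  refine ⟨fun t => l t + Real.pi * I, by fun_prop, fun t => ?_, by ring⟩
  rw [exp_add, hlf, exp_pi_mul_I, mul_neg_one]

theorem exists_isLogIncrement {f : ℝ → ℂ} (hf : Continuous f) (h0 : ∀ t, f t ≠ 0) {a b : ℂ}
    (ha : exp a = f 0) (hb : exp b = f 1) :
    ∃ n : ℤ, IsLogIncrement f (b - a + n * (2 * Real.pi * I)) := by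
  obtain ⟨l, hl, hlf⟩ := exists_continuous_exp_eq hf h0
  obtain ⟨n, hn⟩ := exp_eq_exp_iff_exists_int.1 ((hlf 0).trans ha.symm)
  obtain ⟨m, hm⟩ := exp_eq_exp_iff_exists_int.1 ((hlf 1).trans hb.symm)
  refine ⟨m - n, l, hl, hlf, ?_⟩
  rw [hn, hm]
  push_cast
  ring

/-- The four increments are those of a continuous logarithm of `γ s - δ t` along the sides of the
unit square. -/
theorem IsLogIncrement.add_eq_add_of_disjoint {γ δ : ℝ → ℂ} (hγ : Continuous γ)
    (hδ : Continuous δ) (hne : ∀ s t, γ s ≠ δ t) {d₁ d₂ d₃ d₄ : ℂ}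
    (h₁ : IsLogIncrement (fun s => γ s - δ 0) d₁) (h₂ : IsLogIncrement (fun t => δ t - γ 1) d₂)
    (h₃ : IsLogIncrement (fun t => δ t - γ 0) d₃) (h₄ : IsLogIncrement (fun s => γ s - δ 1) d₄) :
    d₁ + d₂ = d₃ + d₄ := by
  obtain ⟨L, hL, hexp⟩ := exists_continuous_exp_eq (A := ℝ × ℝ)
    (f := fun p => γ p.1 - δ p.2) (by fun_prop) (fun p => sub_ne_zero.2 (hne _ _))
  have e₁ := h₁.unique ⟨fun s => L (s, 0), by fun_prop, fun s => hexp _, rfl⟩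
  have e₂ := h₂.neg.unique
    ⟨fun t => L (1, t), by fun_prop, fun t => (hexp _).trans (neg_sub _ _).symm, rfl⟩
  have e₃ := h₃.neg.unique
    ⟨fun t => L (0, t), by fun_prop, fun t => (hexp _).trans (neg_sub _ _).symm, rfl⟩
  have e₄ := h₄.unique ⟨fun s => L (s, 1), by fun_prop, fun s => hexp _, rfl⟩
  rw [e₁, e₂, e₃, e₄]
  ring

theorem exists_log_sub_of_injective {ι : Type*} [LinearOrder ι] {x : ι → ℂ}
    (hx : Function.Injective x) :
    ∃ Λ : ι → ι → ℂ, (∀ i k, i ≠ k → exp (Λ i k) = x i - x k) ∧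
      ∀ i k, i < k → Λ k i = Λ i k + Real.pi * I := by
  refine ⟨fun i k => if i < k then log (x i - x k) else log (x k - x i) + Real.pi * I,
    fun i k hik => ?_, fun i k hik => ?_⟩
  · rcases lt_or_gt_of_ne hik with h | h
    · simp only [if_pos h, exp_log (sub_ne_zero.2 (hx.ne hik))]
    · simp only [if_neg h.not_gt, exp_add, exp_log (sub_ne_zero.2 (hx.ne hik.symm)), exp_pi_mul_I]
      ring
  · simp only [if_pos hik, if_neg hik.not_gt]

variable {ι κ : Type*} {x : ι → ℂ} {y : κ → ℂ} {γ : ι → κ → ℝ → ℂ}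

/-- The curves `γ i j`, parametrized by `[0, 1]`, draw the complete bipartite graph with vertices
`x i` and `y j` so that edges without a common end are disjoint; edges with a common end may meet.
The curves are defined, and disjoint, on all of `ℝ`, as `Path.extend` provides them. -/
structure IsBipartiteDrawing (x : ι → ℂ) (y : κ → ℂ) (γ : ι → κ → ℝ → ℂ) : Prop where
  continuous : ∀ i j, Continuous (γ i j)
  apply_zero : ∀ i j, γ i j 0 = x i
  apply_one : ∀ i j, γ i j 1 = y j
  apply_ne_apply : ∀ i j k l, i ≠ k → j ≠ l → ∀ s t, γ i j s ≠ γ k l t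

namespace IsBipartiteDrawing

theorem apply_ne_left [Nontrivial κ] (h : IsBipartiteDrawing x y γ) {i k : ι} (hik : i ≠ k)
    (j : κ) (t : ℝ) : γ i j t ≠ x k := by
  obtain ⟨l, hl⟩ := exists_ne j
  simpa only [h.apply_zero] using h.apply_ne_apply i j k l hik hl.symm t 0

theorem apply_ne_right [Nontrivial ι] (h : IsBipartiteDrawing x y γ) (i : ι) {j l : κ}
    (hjl : j ≠ l) (t : ℝ) : γ i j t ≠ y l := by
  obtain ⟨k, hk⟩ := exists_ne i
  simpa only [h.apply_one] using h.apply_ne_apply i j k l hk.symm hjl t 1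

theorem left_ne_right [Nontrivial ι] [Nontrivial κ] (h : IsBipartiteDrawing x y γ) (i : ι)
    (j : κ) : x i ≠ y j := by
  obtain ⟨l, hl⟩ := exists_ne j
  simpa only [h.apply_zero] using h.apply_ne_right i hl 0

theorem left_injective [Nontrivial κ] (h : IsBipartiteDrawing x y γ) :
    Function.Injective x := fun i k hik => by
  obtain ⟨j⟩ : Nonempty κ := inferInstance
  by_contra hne
  exact h.apply_ne_left hne j 0 ((h.apply_zero i j).trans hik)

theorem right_injective [Nontrivial ι] (h : IsBipartiteDrawing x y γ) :
    Function.Injective y := fun j l hjl => by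
  obtain ⟨i⟩ : Nonempty ι := inferInstance
  by_contra hne
  exact h.apply_ne_right i hne 1 ((h.apply_one i j).trans hjl)

variable [Nontrivial ι] [Nontrivial κ]

/-- The integers compare the increment of the logarithm of `γ i j - x k` (respectively of
`γ i j - y l`) with a fixed choice of logarithms of the differences of the end points. -/
theorem exists_int [LinearOrder ι] [LinearOrder κ] (h : IsBipartiteDrawing x y γ) :
    ∃ (m : ι → κ → ι → ℤ) (n : ι → κ → κ → ℤ), ∀ i k j l, i < k → j ≠ l →
      m i j k + n k l j - m k l i - n i j l = if j < l then -1 else 0 := by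
  obtain ⟨Λ, hΛ, hΛs⟩ := exists_log_sub_of_injective h.left_injective
  obtain ⟨M, hM, hMs⟩ := exists_log_sub_of_injective h.right_injective
  have hγ := h.continuous
  have hxy : ∀ i j, exp (log (x i - y j)) = x i - y j := fun i j =>
    exp_log (sub_ne_zero.2 (h.left_ne_right i j))
  have hm : ∀ i j k, i ≠ k → ∃ n : ℤ, IsLogIncrement (fun t => γ i j t - x k)
      (log (x k - y j) + Real.pi * I - Λ i k + n * (2 * Real.pi * I)) := fun i j k hik =>
    exists_isLogIncrement (by fun_prop)
      (fun t => sub_ne_zero.2 (h.apply_ne_left hik j t)) (by rw [h.apply_zero, hΛ i k hik])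
      (by rw [h.apply_one, exp_add, hxy, exp_pi_mul_I]; ring)
  have hn : ∀ i j l, j ≠ l → ∃ n : ℤ, IsLogIncrement (fun t => γ i j t - y l)
      (M j l - log (x i - y l) + n * (2 * Real.pi * I)) := fun i j l hjl =>
    exists_isLogIncrement (by fun_prop)
      (fun t => sub_ne_zero.2 (h.apply_ne_right i hjl t)) (by rw [h.apply_zero, hxy])
      (by rw [h.apply_one, hM j l hjl])
  choose! m hm using hm
  choose! n hn using hn
  refine ⟨m, n, fun i k j l hik hjl => ?_⟩
  have hsum := IsLogIncrement.add_eq_add_of_disjoint (hγ i j) (hγ k l)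
    (h.apply_ne_apply i j k l hik.ne hjl)
    (by simpa only [h.apply_zero] using hm i j k hik.ne)
    (by simpa only [h.apply_one] using hn k l j hjl.symm)
    (by simpa only [h.apply_zero] using hm k l i hik.ne')
    (by simpa only [h.apply_one] using hn i j l hjl)
  suffices hC : ((m i j k + n k l j - m k l i - n i j l : ℤ) : ℂ) * (2 * Real.pi * I) =
      ((if j < l then -1 else 0 : ℤ) : ℂ) * (2 * Real.pi * I) by
    exact_mod_cast mul_right_cancel₀ two_pi_I_ne_zero hC
  rcases lt_or_gt_of_ne hjl with hlt | hlt
  · rw [if_pos hlt]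
    push_cast
    linear_combination hsum - hΛs i k hik - hMs j l hlt
  · rw [if_neg hlt.not_gt]
    push_cast
    linear_combination hsum - hΛs i k hik + hMs l j hlt

end IsBipartiteDrawing

end LogIncrement

/-- Summed over all `i < k` and `j ≠ l`, the left-hand sides contain every integer an even number of
times, whereas the right-hand sides add up to `-9`. -/
theorem not_forall_fin_three_add_sub_eq (m n : Fin 3 → Fin 3 → Fin 3 → ℤ) :
    ¬ ∀ i k j l, i < k → j ≠ l →
      m i j k + n k l j - m k l i - n i j l = if j < l then -1 else 0 := by
  intro h
  have hjl : ∀ i k, i < k → _ := fun i k hik =>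
    And.intro (h i k 0 1 hik (by decide)) <| And.intro (h i k 0 2 hik (by decide)) <|
    And.intro (h i k 1 2 hik (by decide)) <| And.intro (h i k 1 0 hik (by decide)) <|
    And.intro (h i k 2 0 hik (by decide)) (h i k 2 1 hik (by decide))
  have h01 := hjl 0 1 (by decide)
  have h02 := hjl 0 2 (by decide)
  have h12 := hjl 1 2 (by decide)
  simp only [Fin.reduceLT, if_true, if_false] at h01 h02 h12
  omega

/-- `K_{3,3}` is not planar, for curves running in prescribed sets: the curve from `x i` to `y j`
runs in `T i j`. -/
theorem not_joinedIn_K33 (x y : Fin 3 → Plane) (T : Fin 3 → Fin 3 → Set Plane)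
    (hT : ∀ i j, JoinedIn (T i j) (x i) (y j))
    (hdis : ∀ i j k l, i ≠ k → j ≠ l → Disjoint (T i j) (T k l)) : False := by
  let φ : Plane ≃ₗᵢ[ℝ] ℂ := Complex.orthonormalBasisOneI.repr.symm
  have hdrawing : IsBipartiteDrawing (φ ∘ x) (φ ∘ y)
      fun i j t => φ ((hT i j).somePath.extend t) :=
    { continuous := fun i j => φ.continuous.comp (hT i j).somePath.continuous_extend
      apply_zero := fun i j => by simp only [Path.extend_zero, Function.comp_apply]
      apply_one := fun i j => by simp only [Path.extend_one, Function.comp_apply]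
      apply_ne_apply := fun i j k l hik hjl s t hst =>
        Set.disjoint_left.1 (hdis i j k l hik hjl) ((hT i j).somePath_mem _)
          (φ.injective hst ▸ (hT k l).somePath_mem _) }
  obtain ⟨m, n, h⟩ := hdrawing.exists_int
  exact not_forall_fin_three_add_sub_eq m n h

/-! ### Reachability inside a vertex set -/

section ReachableIn

variable {V : Type*} {G : SimpleGraph V} {S T : Set V} {x y : V}

/-- `y` can be reached from `x` by a walk of `G` all of whose edges have both ends in `S`. The end
`x = y` of a trivial walk need not lie in `S`. -/
abbrev ReachableIn (G : SimpleGraph V) (S : Set V) (x y : V) : Prop :=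
  (G.induce S).spanningCoe.Reachable x y

theorem spanningCoe_induce_adj : (G.induce S).spanningCoe.Adj x y ↔ G.Adj x y ∧ x ∈ S ∧ y ∈ S := by
  simp only [SimpleGraph.map_adj, SimpleGraph.comap_adj, Function.Embedding.subtype_apply]
  exact ⟨fun ⟨a, b, hab, ha, hb⟩ => ha ▸ hb ▸ ⟨hab, a.2, b.2⟩,
    fun ⟨hxy, hx, hy⟩ => ⟨⟨x, hx⟩, ⟨y, hy⟩, hxy, rfl, rfl⟩⟩

theorem reachableIn_of_adj (h : G.Adj x y) (hx : x ∈ S) (hy : y ∈ S) : ReachableIn G S x y :=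
  SimpleGraph.Adj.reachable (spanningCoe_induce_adj.2 ⟨h, hx, hy⟩)

theorem ReachableIn.mono (hST : S ⊆ T) (h : ReachableIn G S x y) : ReachableIn G T x y :=
  SimpleGraph.Reachable.mono (fun _ _ hab =>
    have ⟨hG, ha, hb⟩ := spanningCoe_induce_adj.1 hab
    spanningCoe_induce_adj.2 ⟨hG, hST ha, hST hb⟩) h

@[elab_as_elim]
theorem ReachableIn.induction {motive : ∀ y, ReachableIn G S x y → Prop}
    (refl : motive x (SimpleGraph.Reachable.refl x))
    (tail : ∀ {a b} (hxa : ReachableIn G S x a) (hab : G.Adj a b) (ha : a ∈ S) (hb : b ∈ S),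
      motive a hxa → motive b (hxa.trans (reachableIn_of_adj hab ha hb)))
    {y : V} (h : ReachableIn G S x y) : motive y h := by
  have hgen := (SimpleGraph.reachable_iff_reflTransGen x y).1 h
  induction hgen with
  | refl => exact refl
  | tail hxa hab ih =>
    obtain ⟨hG, ha, hb⟩ := spanningCoe_induce_adj.1 hab
    exact tail ((SimpleGraph.reachable_iff_reflTransGen x _).2 hxa) hG ha hb (ih _)

theorem ReachableIn.mem (h : ReachableIn G S x y) (hx : x ∈ S) : y ∈ S := by
  induction h using ReachableIn.induction with
  | refl => exact hx
  | tail _ _ _ hb => exact hb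

theorem reachableIn_of_chain {f : ℕ → V} {m n : ℕ} (hmn : m ≤ n)
    (hadj : ∀ k, m ≤ k → k < n → G.Adj (f k) (f (k + 1)))
    (hS : ∀ k, m ≤ k → k ≤ n → f k ∈ S) : ReachableIn G S (f m) (f n) := by
  induction n, hmn using Nat.le_induction with
  | base => exact .refl _
  | succ n hmn ih =>
    exact (ih (fun k h1 h2 => hadj k h1 (h2.trans n.lt_succ_self))
      (fun k h1 h2 => hS k h1 (h2.trans n.le_succ))).trans
      (reachableIn_of_adj (hadj n hmn n.lt_succ_self) (hS n hmn n.le_succ)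
        (hS _ (hmn.trans n.le_succ) le_rfl))

theorem induce_connected_iff :
    (G.induce S).Connected ↔ S.Nonempty ∧ ∀ x ∈ S, ∀ y ∈ S, ReachableIn G S x y := by
  rw [SimpleGraph.connected_iff, and_comm, Set.nonempty_coe_sort]
  refine and_congr_right fun _ => ⟨fun h x hx y hy => ?_, fun h ⟨x, hx⟩ ⟨y, hy⟩ => ?_⟩
  · exact (h ⟨x, hx⟩ ⟨y, hy⟩).map (SimpleGraph.Embedding.spanningCoe _).toHom
  · suffices ∀ hy : y ∈ S, (G.induce S).Reachable ⟨x, hx⟩ ⟨y, hy⟩ from this hy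
    induction h x hx y hy using ReachableIn.induction with
    | refl => exact fun _ => .refl _
    | tail _ hab ha _ ih =>
      exact fun _ => (ih ha ha).trans (SimpleGraph.Adj.reachable (SimpleGraph.comap_adj.2 hab))

theorem ReachableIn.exists_adj_notMem (h : ReachableIn G S x y) (hx : x ∈ T) (hy : y ∉ T) :
    ∃ a ∈ S, a ∈ T ∧ ∃ b ∈ S, b ∉ T ∧ G.Adj a b := by
  induction h using ReachableIn.induction with
  | refl => exact absurd hx hy
  | @tail a b _ hab ha hb ih =>
    by_cases haT : a ∈ T
    exacts [⟨a, ha, haT, b, hb, hy, hab⟩, ih haT]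

theorem exists_adj_notMem_of_connected (hS : (G.induce S).Connected) (hx : x ∈ S) (hxT : x ∈ T)
    (hST : ¬ S ⊆ T) : ∃ a ∈ S, a ∈ T ∧ ∃ b ∈ S, b ∉ T ∧ G.Adj a b := by
  obtain ⟨y, hy, hyT⟩ := Set.not_subset.1 hST
  exact ((induce_connected_iff.1 hS).2 x hx y hy).exists_adj_notMem hxT hyT

end ReachableIn

/-! ### The edges of the windmill -/

/-- The windmill with `p` vanes of length `2 * q`. -/
def windmillGraph (p q : ℕ) : SimpleGraph (WindmillVertex p q) :=
  SimpleGraph.fromRel WindmillVertex.Edge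

namespace WindmillVertex

variable {p q : ℕ}

instance : Finite (WindmillVertex p q) := by
  refine Finite.of_injective (β := Fin 6 × WithBot (Fin p) × WithBot (Set.Icc 2 (2 * q)))
    (fun x => match x with
      | z => (0, ⊥, ⊥)
      | u i => (1, i, ⊥)
      | v i => (2, i, ⊥)
      | a i j => (3, i, j)
      | b i j => (4, i, j)
      | c i j => (5, i, j)) ?_
  intro x y
  cases x <;> cases y <;> simp

/-- The edges of the windmill, in terms of the constructors of `WindmillVertex`: with paths that
start at the dedicated vertices `u i` and `v i`, case analysis on `Step` replaces computations with
the conditionals in `pathA`, `pathB` and `pathC`. -/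
inductive Step : WindmillVertex p q → WindmillVertex p q → Prop
  | uv (i) : Step (u i) (v i)
  | vu (i) : Step (v i) (u (finRotate p i))
  | zu (i) : Step z (u i)
  | zv (i) : Step z (v i)
  | ua (i) (h) : Step (u i) (a i ⟨2, h⟩)
  | vb (i) (h) : Step (v i) (b i ⟨2, h⟩)
  | uc (i) (h) : Step (u (finRotate p i)) (c i ⟨2, h⟩)
  | aa (i j h h') : Step (a i ⟨j, h⟩) (a i ⟨j + 1, h'⟩)
  | bb (i j h h') : Step (b i ⟨j, h⟩) (b i ⟨j + 1, h'⟩)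
  | cc (i j h h') : Step (c i ⟨j, h⟩) (c i ⟨j + 1, h'⟩)
  | ab (i j) : Step (a i j) (b i j)
  | bc (i j) : Step (b i j) (c i j)
  | ac (i) (j : Set.Icc 2 (2 * q)) (h : (j : ℕ) = 2 * q) : Step (a i j) (c i j)

theorem step_of_edge {x y : WindmillVertex p q} (h : Edge x y) : Step x y := by
  rcases h with ⟨i, rfl, rfl⟩ | ⟨i, rfl, rfl⟩ | ⟨i, rfl, rfl⟩ | ⟨i, rfl, rfl⟩ |
    ⟨i, ⟨j, hj⟩, ⟨k, hk⟩, hjk, h⟩ | ⟨i, ⟨j, hj⟩, h2, h⟩ | ⟨i, ⟨j, hj⟩, htop, rfl, rfl⟩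
  · exact .uv i
  · exact .vu i
  · exact .zu i
  · exact .zv i
  · obtain rfl : k = j + 1 := hjk
    have h2 : 2 ≤ j + 1 := Nat.succ_le_succ hj.1
    simp only [pathA, pathB, pathC, h2, dif_pos] at h
    by_cases h2j : 2 ≤ j
    · simp only [h2j, dif_pos] at h
      rcases h with ⟨rfl, rfl⟩ | ⟨rfl, rfl⟩ | ⟨rfl, rfl⟩
      exacts [.aa .., .bb .., .cc ..]
    · obtain rfl : j = 1 := le_antisymm (by omega) hj.1
      simp only [h2j, dif_neg, not_false_iff] at h
      rcases h with ⟨rfl, rfl⟩ | ⟨rfl, rfl⟩ | ⟨rfl, rfl⟩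
      exacts [.ua .., .vb .., .uc ..]
  · simp only at h2
    simp only [pathA, pathB, pathC, h2, dif_pos] at h
    rcases h with ⟨rfl, rfl⟩ | ⟨rfl, rfl⟩
    exacts [.ab .., .bc ..]
  · simp only at htop
    have h2 : 2 ≤ j := by have := hj.1; omega
    simp only [pathA, pathC, h2, dif_pos]
    exact .ac _ _ htop

theorem edge_path_succ (i : Fin p) {j : ℕ} (h1 : 1 ≤ j) (h2 : j + 1 ≤ 2 * q) :
    Edge (pathA i ⟨j, h1, j.le_succ.trans h2⟩) (pathA i ⟨j + 1, j.succ_pos, h2⟩) ∧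
      Edge (pathB i ⟨j, h1, j.le_succ.trans h2⟩) (pathB i ⟨j + 1, j.succ_pos, h2⟩) ∧
      Edge (pathC i ⟨j, h1, j.le_succ.trans h2⟩) (pathC i ⟨j + 1, j.succ_pos, h2⟩) :=
  have edge_of {x y : WindmillVertex p q} (h : (x = pathA i ⟨j, _⟩ ∧ y = pathA i ⟨j + 1, _⟩) ∨
      (x = pathB i ⟨j, _⟩ ∧ y = pathB i ⟨j + 1, _⟩) ∨
      (x = pathC i ⟨j, _⟩ ∧ y = pathC i ⟨j + 1, _⟩)) : Edge x y :=
    .inr <| .inr <| .inr <| .inr <| .inl ⟨i, _, _, rfl, h⟩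
  ⟨edge_of (.inl ⟨rfl, rfl⟩), edge_of (.inr (.inl ⟨rfl, rfl⟩)), edge_of (.inr (.inr ⟨rfl, rfl⟩))⟩

theorem edge_of_step {x y : WindmillVertex p q} (h : Step x y) : Edge x y := by
  cases h with
  | uv i => exact .inl ⟨i, rfl, rfl⟩
  | vu i => exact .inr <| .inl ⟨i, rfl, rfl⟩
  | zu i => exact .inr <| .inr <| .inl ⟨i, rfl, rfl⟩
  | zv i => exact .inr <| .inr <| .inr <| .inl ⟨i, rfl, rfl⟩
  | ua i h => exact (edge_path_succ i le_rfl h.2).1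
  | vb i h => exact (edge_path_succ i le_rfl h.2).2.1
  | uc i h => exact (edge_path_succ i le_rfl h.2).2.2
  | aa i j h h' =>
    simpa only [pathA, h.1, h'.1, dif_pos] using (edge_path_succ i (one_le_two.trans h.1) h'.2).1
  | bb i j h h' =>
    simpa only [pathB, h.1, h'.1, dif_pos] using (edge_path_succ i (one_le_two.trans h.1) h'.2).2.1
  | cc i j h h' =>
    simpa only [pathC, h.1, h'.1, dif_pos] using (edge_path_succ i (one_le_two.trans h.1) h'.2).2.2
  | ab i j =>
    exact .inr <| .inr <| .inr <| .inr <| .inr <| .inl ⟨i, ⟨j, one_le_two.trans j.2.1, j.2.2⟩,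
      j.2.1, .inl (by simp only [pathA, pathB, j.2.1, dif_pos, and_self])⟩
  | bc i j =>
    exact .inr <| .inr <| .inr <| .inr <| .inr <| .inl ⟨i, ⟨j, one_le_two.trans j.2.1, j.2.2⟩,
      j.2.1, .inr (by simp only [pathB, pathC, j.2.1, dif_pos, and_self])⟩
  | ac i j h =>
    exact .inr <| .inr <| .inr <| .inr <| .inr <| .inr ⟨i, ⟨j, one_le_two.trans j.2.1, j.2.2⟩,
      h, by simp only [pathA, pathC, j.2.1, dif_pos, and_self]⟩

theorem Step.ne {x y : WindmillVertex p q} (h : Step x y) : x ≠ y := by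
  cases h <;> simp

theorem adj_iff {x y : WindmillVertex p q} :
    (windmillGraph p q).Adj x y ↔ Step x y ∨ Step y x := by
  rw [windmillGraph, SimpleGraph.fromRel_adj]
  constructor
  · rintro ⟨-, h | h⟩
    exacts [.inl (step_of_edge h), .inr (step_of_edge h)]
  · rintro (h | h)
    exacts [⟨h.ne, .inl (edge_of_step h)⟩, ⟨h.ne.symm, .inr (edge_of_step h)⟩]

theorem Step.adj {x y : WindmillVertex p q} (h : Step x y) : (windmillGraph p q).Adj x y :=
  adj_iff.2 (.inl h)

theorem adj_induction {P : WindmillVertex p q → WindmillVertex p q → Prop}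
    (h : ∀ x y, Step x y → P x y ∧ P y x) {x y : WindmillVertex p q}
    (hxy : (windmillGraph p q).Adj x y) : P x y := by
  rcases adj_iff.1 hxy with hs | hs
  exacts [(h _ _ hs).1, (h _ _ hs).2]

/-- The path with first vertex `x` and further vertices `f 2, f 3, …, f (2 * q)`, as a function on
all of `ℕ`. -/
def column (x : WindmillVertex p q) (f : Set.Icc 2 (2 * q) → WindmillVertex p q) (j : ℕ) :
    WindmillVertex p q :=
  if h : j ∈ Set.Icc 2 (2 * q) then f ⟨j, h⟩ else x

section column

variable {x : WindmillVertex p q} {f : Set.Icc 2 (2 * q) → WindmillVertex p q} {j : ℕ}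

theorem column_of_mem (h : j ∈ Set.Icc 2 (2 * q)) : column x f j = f ⟨j, h⟩ :=
  dif_pos h

theorem column_one : column x f 1 = x :=
  dif_neg fun h => absurd h.1 (by decide)

theorem column_mem {S : Set (WindmillVertex p q)} (hx : x ∈ S)
    (hf : ∀ k : Set.Icc 2 (2 * q), (k : ℕ) = j → f k ∈ S) : column x f j ∈ S := by
  unfold column
  split_ifs with h
  exacts [hf ⟨j, h⟩ rfl, hx]

theorem adj_column (hx : ∀ h, Step x (f ⟨2, h⟩)) (hf : ∀ j h h', Step (f ⟨j, h⟩) (f ⟨j + 1, h'⟩))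
    (h1 : 1 ≤ j) (h2 : j + 1 ≤ 2 * q) :
    (windmillGraph p q).Adj (column x f j) (column x f (j + 1)) := by
  rw [column_of_mem (j := j + 1) ⟨by omega, h2⟩]
  rcases h1.eq_or_lt with rfl | h1
  · rw [column_one]
    exact (hx _).adj
  · rw [column_of_mem (j := j) ⟨h1, by omega⟩]
    exact (hf ..).adj

end column

/-- The `j`-th vertex of the first path of the `i`-th vane, for `1 ≤ j ≤ 2 * q`; it is `pathA i j`
with an argument in `ℕ`. -/
abbrev colA (i : Fin p) : ℕ → WindmillVertex p q := column (u i) (a i)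

/-- The `j`-th vertex of the second path of the `i`-th vane, for `1 ≤ j ≤ 2 * q`; it is `pathB i j`
with an argument in `ℕ`. -/
abbrev colB (i : Fin p) : ℕ → WindmillVertex p q := column (v i) (b i)

/-- The `j`-th vertex of the third path of the `i`-th vane, for `1 ≤ j ≤ 2 * q`; it is `pathC i j`
with an argument in `ℕ`. -/
abbrev colC (i : Fin p) : ℕ → WindmillVertex p q := column (u (finRotate p i)) (c i)

theorem pathB_eq (i : Fin p) (j : Set.Icc 1 (2 * q)) : pathB i j = colB i j := by
  have h : (j : ℕ) ∈ Set.Icc 2 (2 * q) ↔ 2 ≤ (j : ℕ) := and_iff_left j.2.2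
  simp only [pathB, column, h]

variable (i : Fin p) {j : ℕ}

theorem adj_colA (h1 : 1 ≤ j) (h2 : j + 1 ≤ 2 * q) :
    (windmillGraph p q).Adj (colA i j) (colA i (j + 1)) :=
  adj_column (.ua i) (.aa i) h1 h2

theorem adj_colB (h1 : 1 ≤ j) (h2 : j + 1 ≤ 2 * q) :
    (windmillGraph p q).Adj (colB i j) (colB i (j + 1)) :=
  adj_column (.vb i) (.bb i) h1 h2

theorem adj_colC (h1 : 1 ≤ j) (h2 : j + 1 ≤ 2 * q) :
    (windmillGraph p q).Adj (colC i j) (colC i (j + 1)) :=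
  adj_column (.uc i) (.cc i) h1 h2

theorem adj_colA_colB (h : j ∈ Set.Icc 2 (2 * q)) :
    (windmillGraph p q).Adj (colA i j) (colB i j) := by
  simp only [column_of_mem h]
  exact (Step.ab ..).adj

theorem adj_colB_colC (h : j ∈ Set.Icc 2 (2 * q)) :
    (windmillGraph p q).Adj (colB i j) (colC i j) := by
  simp only [column_of_mem h]
  exact (Step.bc ..).adj

theorem adj_colA_colC (hq : 1 ≤ q) :
    (windmillGraph p q).Adj (colA i (2 * q)) (colC i (2 * q)) := by
  have h : 2 * q ∈ Set.Icc 2 (2 * q) := ⟨by omega, le_rfl⟩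
  simp only [column_of_mem h]
  exact (Step.ac _ _ rfl).adj

end WindmillVertex

/-! ### Faces of a plane graph and rooted vertices -/

namespace PlaneEmbedding

variable {V : Type*} {G : SimpleGraph V} (E : PlaneEmbedding G) {S T : Set V}

/-- The part of the embedded graph formed by the vertices in `S` and the edges inside `S`. -/
def carrierOn (S : Set V) : Set Plane :=
  E.point '' S ∪ ⋃ e : G.edgeSet, ⋃ _ : ∀ w ∈ (e : Sym2 V), w ∈ S, E.arc e

theorem carrierOn_subset : E.carrierOn S ⊆ E.carrier :=
  Set.union_subset_union (Set.image_subset_range _ _)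
    (Set.iUnion_mono fun _ => Set.iUnion_subset fun _ => subset_rfl)

theorem carrierOn_mono (h : S ⊆ T) : E.carrierOn S ⊆ E.carrierOn T :=
  Set.union_subset_union (Set.image_mono h) (Set.iUnion_mono fun _ =>
    Set.iUnion_mono' fun hS => ⟨fun w hw => h (hS w hw), subset_rfl⟩)

theorem point_mem_carrierOn_iff {v : V} : E.point v ∈ E.carrierOn S ↔ v ∈ S := by
  constructor
  · rintro (⟨w, hw, h⟩ | h)
    · rwa [← E.point_injective h]
    · obtain ⟨e, hS, he⟩ := Set.mem_iUnion₂.1 h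
      exact hS v (E.mem_of_point_mem e v he)
  · exact fun hv => .inl ⟨v, hv, rfl⟩

theorem disjoint_carrierOn (h : Disjoint S T) : Disjoint (E.carrierOn S) (E.carrierOn T) := by
  rw [Set.disjoint_left] at h ⊢
  rintro x (⟨v, hv, rfl⟩ | hx) hx'
  · exact h hv (E.point_mem_carrierOn_iff.1 hx')
  · rcases hx' with ⟨w, hw, rfl⟩ | hx'
    · exact h (E.point_mem_carrierOn_iff.1 (.inr hx)) hw
    · obtain ⟨e, hS, he⟩ := Set.mem_iUnion₂.1 hx
      obtain ⟨e', hT, he'⟩ := Set.mem_iUnion₂.1 hx'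
      have hne : e ≠ e' := by
        rintro rfl
        obtain ⟨⟨v, w⟩, _⟩ := e
        exact h (hS v (Sym2.mem_mk_left v w)) (hT v (Sym2.mem_mk_left v w))
      obtain ⟨w, hw, hw', -⟩ := E.arc_inter e e' hne x ⟨he, he'⟩
      exact h (hS w hw) (hT w hw')

theorem isCompact_arc (e : G.edgeSet) : IsCompact (E.arc e) := by
  obtain ⟨⟨v, w⟩, hvw⟩ := e
  obtain ⟨γ, -, hγ⟩ := E.isArc v w hvw
  exact hγ ▸ isCompact_range γ.continuous

theorem isClosed_carrierOn [Finite V] : IsClosed (E.carrierOn S) :=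
  (S.toFinite.image _).isClosed.union <| isClosed_iUnion_of_finite fun e =>
    isClosed_iUnion_of_finite fun _ => (E.isCompact_arc e).isClosed

theorem joinedIn_of_reachableIn {v w : V} (h : ReachableIn G S v w) (hv : v ∈ S) :
    JoinedIn (E.carrierOn S) (E.point v) (E.point w) := by
  induction h using ReachableIn.induction with
  | refl => exact JoinedIn.refl (.inl ⟨v, hv, rfl⟩)
  | @tail x y _ hxy hx hy ih =>
    obtain ⟨γ, -, hγ⟩ := E.isArc x y hxy
    refine ih.trans ⟨γ, fun t => .inr (Set.mem_iUnion₂.2 ⟨⟨s(x, y), hxy⟩, ?_, hγ ▸ ⟨t, rfl⟩⟩)⟩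
    intro w hw
    rcases Sym2.mem_iff.1 hw with rfl | rfl
    exacts [hx, hy]

theorem joinedIn_of_isIncident [Finite V] {F : Set Plane} (hF : E.IsFace F) {v w : V}
    (hv : E.IsIncident v F) (hw : E.IsIncident w F) (hvS : v ∉ S) (hwS : w ∉ S) :
    JoinedIn (E.carrierOn S)ᶜ (E.point v) (E.point w) := by
  obtain ⟨x, -, rfl⟩ := hF
  set F := connectedComponentIn E.carrierᶜ x
  set F' := F ∪ {E.point v, E.point w}
  have hF' : IsPreconnected F' :=
    isPreconnected_connectedComponentIn.subset_closure Set.subset_union_left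
      (Set.union_subset subset_closure
        (Set.pair_subset (frontier_subset_closure hv) (frontier_subset_closure hw)))
  have hsub : F' ⊆ (E.carrierOn S)ᶜ := Set.union_subset
    ((connectedComponentIn_subset _ _).trans (Set.compl_subset_compl.2 E.carrierOn_subset))
    (Set.pair_subset (mt E.point_mem_carrierOn_iff.1 hvS) (mt E.point_mem_carrierOn_iff.1 hwS))
  have hv' : E.point v ∈ F' := .inr (.inl rfl)
  have hw' : E.point w ∈ F' := .inr (.inr rfl)
  have hopen : IsOpen (E.carrierOn S)ᶜ := E.isClosed_carrierOn.isOpen_compl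
  have hpath := hopen.connectedComponentIn.isConnected_iff_isPathConnected.1
    (isConnected_connectedComponentIn_iff.2 (hsub hv'))
  exact (hpath.joinedIn _ (mem_connectedComponentIn (hsub hv')) _
    (hF'.subset_connectedComponentIn hv' hsub hw')).mono (connectedComponentIn_subset _ _)

/-- The sets `S i j` contain the paths of a subdivision of `K_{3,3}` minus an edge. The missing edge
between `x 2` and `y 2` could be drawn inside a common face of these two vertices. -/
theorem not_isIncident_of_K33 [Finite V] (x y : Fin 3 → V) (S : Fin 3 → Fin 3 → Set V)
    (hmem : ∀ i j, i ≠ 2 ∨ j ≠ 2 → x i ∈ S i j)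
    (hreach : ∀ i j, i ≠ 2 ∨ j ≠ 2 → ReachableIn G (S i j) (x i) (y j))
    (hdis : ∀ i j k l, i ≠ 2 ∨ j ≠ 2 → k ≠ 2 ∨ l ≠ 2 → i ≠ k → j ≠ l → Disjoint (S i j) (S k l))
    {F : Set Plane} (hF : E.IsFace F) (hxF : E.IsIncident (x 2) F) :
    ¬ E.IsIncident (y 2) F := by
  intro hyF
  set R : Set V := {w | ∃ i j, i ≠ 2 ∧ j ≠ 2 ∧ w ∈ S i j}
  have hSR : ∀ i j, i ≠ 2 → j ≠ 2 → S i j ⊆ R := fun i j hi hj w hw => ⟨i, j, hi, hj, hw⟩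
  have hthird : ∀ i : Fin 3, ∃ k, k ≠ 2 ∧ k ≠ i := by decide
  have hxR : x 2 ∉ R := by
    rintro ⟨i, j, hi, -, hx⟩
    obtain ⟨l, hl, hlj⟩ := hthird j
    exact Set.disjoint_left.1 (hdis i j 2 l (.inl hi) (.inr hl) hi hlj.symm) hx
      (hmem 2 l (.inr hl))
  have hyR : y 2 ∉ R := by
    rintro ⟨i, j, hi, hj, hy⟩
    obtain ⟨k, hk, hki⟩ := hthird i
    exact Set.disjoint_left.1 (hdis i j k 2 (.inl hi) (.inl hk) hki.symm hj) hy
      ((hreach k 2 (.inl hk)).mem (hmem k 2 (.inl hk)))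
  refine not_joinedIn_K33 (E.point ∘ x) (E.point ∘ y)
    (fun i j => if i ≠ 2 ∨ j ≠ 2 then E.carrierOn (S i j) else (E.carrierOn R)ᶜ)
    (fun i j => ?_) (fun i j k l hik hjl => ?_)
  · split_ifs with h
    · exact E.joinedIn_of_reachableIn (hreach i j h) (hmem i j h)
    · obtain ⟨rfl, rfl⟩ : i = 2 ∧ j = 2 := by simpa only [not_or, not_not] using h
      exact E.joinedIn_of_isIncident hF hxF hyF hxR hyR
  · split_ifs with h h' h'
    · exact E.disjoint_carrierOn (hdis i j k l h h' hik hjl)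
    · obtain ⟨rfl, rfl⟩ : k = 2 ∧ l = 2 := by simpa only [not_or, not_not] using h'
      exact Set.disjoint_compl_right_iff_subset.2 (E.carrierOn_mono (hSR i j hik hjl))
    · obtain ⟨rfl, rfl⟩ : i = 2 ∧ j = 2 := by simpa only [not_or, not_not] using h
      exact Set.disjoint_compl_left_iff_subset.2 (E.carrierOn_mono (hSR k l hik.symm hjl.symm))
    · omega

end PlaneEmbedding

namespace WindmillVertex

variable {p q : ℕ}

/-- The vertices that do not lie in rows `≥ m` of the `i`-th vane. -/
def below (i : Fin p) (m : ℕ) : Set (WindmillVertex p q) :=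
  {x | match x with
    | a i' j | b i' j | c i' j => i' = i → (j : ℕ) < m
    | _ => True}

section below

variable {i i' : Fin p} {m j : ℕ}

theorem colB_mem_below (h : i' = i → j < m) : (colB i' j : WindmillVertex p q) ∈ below i m :=
  column_mem trivial fun _ hk hi => hk ▸ h hi

theorem reachableIn_below_z (hj : 1 ≤ j) (hjq : j ≤ 2 * q) (h : i' = i → j < m) :
    ReachableIn (windmillGraph p q) (below i m) (colB i' j) z := by
  have hvb := reachableIn_of_chain (G := windmillGraph p q) (S := below i m) (f := colB i') hj
    (fun k hk hkj => adj_colB i' hk (by omega))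
    (fun k _ hkj => colB_mem_below fun hi => hkj.trans_lt (h hi))
  simp only [column_one] at hvb
  exact hvb.symm.trans (reachableIn_of_adj (Step.zv i').adj.symm trivial trivial)

theorem reachableIn_insert_colA (hm : 1 ≤ m) (hmq : m ≤ 2 * q) :
    ReachableIn (windmillGraph p q) (insert (colA i m) (below i m)) z (colA i m) := by
  have hua := reachableIn_of_chain (G := windmillGraph p q)
    (S := insert (colA i m) (below i m)) (f := colA i) hm
    (fun k hk hkm => adj_colA i hk (by omega)) fun k _ hkm => by
      rcases hkm.eq_or_lt with rfl | hkm
      exacts [.inl rfl, .inr (column_mem trivial fun _ hl _ => hl ▸ hkm)]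
  simp only [column_one] at hua
  exact (reachableIn_of_adj (Step.zu i).adj (.inr trivial) (.inr trivial)).trans hua

theorem reachableIn_insert_colC (hm : 1 ≤ m) (hmq : m ≤ 2 * q) :
    ReachableIn (windmillGraph p q) (insert (colC i m) (below i m)) z (colC i m) := by
  have huc := reachableIn_of_chain (G := windmillGraph p q)
    (S := insert (colC i m) (below i m)) (f := colC i) hm
    (fun k hk hkm => adj_colC i hk (by omega)) fun k _ hkm => by
      rcases hkm.eq_or_lt with rfl | hkm
      exacts [.inl rfl, .inr (column_mem trivial fun _ hl _ => hl ▸ hkm)]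
  simp only [column_one] at huc
  exact (reachableIn_of_adj (Step.zu _).adj (.inr trivial) (.inr trivial)).trans huc

end below

section ladder

variable (i : Fin p) {m : ℕ} (h₀ : m ∈ Set.Icc 2 (2 * q)) (h₁ : m + 1 ∈ Set.Icc 2 (2 * q))
  (h₂ : m + 2 ∈ Set.Icc 2 (2 * q))

/-- The vertex sets of the paths of a subdivided `K_{3,3}` minus an edge in the windmill. Three
branch vertices are `b_{i,m}`, `b_{i,m+2}` and any vertex below row `m`; the other three are
`a_{i,m}`, `c_{i,m}` and `b_{i,m+1}`, and the missing edge ends in `b_{i,m+1}`. -/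
def ladderPath : Fin 3 → Fin 3 → Set (WindmillVertex p q) :=
  ![![{b i ⟨m, h₀⟩, a i ⟨m, h₀⟩}, {b i ⟨m, h₀⟩, c i ⟨m, h₀⟩}, {b i ⟨m, h₀⟩, b i ⟨m + 1, h₁⟩}],
    ![{b i ⟨m + 2, h₂⟩, a i ⟨m + 2, h₂⟩, a i ⟨m + 1, h₁⟩, a i ⟨m, h₀⟩},
      {b i ⟨m + 2, h₂⟩, c i ⟨m + 2, h₂⟩, c i ⟨m + 1, h₁⟩, c i ⟨m, h₀⟩},
      {b i ⟨m + 2, h₂⟩, b i ⟨m + 1, h₁⟩}],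
    ![insert (a i ⟨m, h₀⟩) (below i m), insert (c i ⟨m, h₀⟩) (below i m), ∅]]

theorem disjoint_ladderPath {k l k' l' : Fin 3} (hk : k ≠ k') (hl : l ≠ l') :
    Disjoint (ladderPath i h₀ h₁ h₂ k l) (ladderPath i h₀ h₁ h₂ k' l') := by
  fin_cases k <;> fin_cases k' <;> first | exact absurd rfl hk | skip
  all_goals fin_cases l <;> fin_cases l' <;> first | exact absurd rfl hl | simp [ladderPath, below]

theorem mem_ladderPath {y : WindmillVertex p q} (hy : y ∈ below i m) :
    ∀ k l : Fin 3, k ≠ 2 ∨ l ≠ 2 →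
      ![b i ⟨m, h₀⟩, b i ⟨m + 2, h₂⟩, y] k ∈ ladderPath i h₀ h₁ h₂ k l
  | 0, 0, _ | 0, 1, _ | 0, 2, _ | 1, 0, _ | 1, 1, _ | 1, 2, _ => .inl rfl
  | 2, 0, _ | 2, 1, _ => .inr hy
  | 2, 2, h => by simp at h

theorem reachableIn_ladderPath {y : WindmillVertex p q}
    (hy : ReachableIn (windmillGraph p q) (below i m) y z) :
    ∀ k l : Fin 3, k ≠ 2 ∨ l ≠ 2 → ReachableIn (windmillGraph p q) (ladderPath i h₀ h₁ h₂ k l)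
      (![b i ⟨m, h₀⟩, b i ⟨m + 2, h₂⟩, y] k) (![a i ⟨m, h₀⟩, c i ⟨m, h₀⟩, b i ⟨m + 1, h₁⟩] l)
  | 0, 0, _ => reachableIn_of_adj (Step.ab ..).adj.symm (.inl rfl) (.inr rfl)
  | 0, 1, _ => reachableIn_of_adj (Step.bc ..).adj (.inl rfl) (.inr rfl)
  | 0, 2, _ => reachableIn_of_adj (Step.bb ..).adj (.inl rfl) (.inr rfl)
  | 1, 0, _ => ((reachableIn_of_adj (Step.ab ..).adj.symm (.inl rfl) (.inr (.inl rfl))).trans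
      (reachableIn_of_adj (Step.aa i (m + 1) h₁ h₂).adj.symm (.inr (.inl rfl))
        (.inr (.inr (.inl rfl))))).trans
      (reachableIn_of_adj (Step.aa ..).adj.symm (.inr (.inr (.inl rfl))) (.inr (.inr (.inr rfl))))
  | 1, 1, _ => ((reachableIn_of_adj (Step.bc ..).adj (.inl rfl) (.inr (.inl rfl))).trans
      (reachableIn_of_adj (Step.cc i (m + 1) h₁ h₂).adj.symm (.inr (.inl rfl))
        (.inr (.inr (.inl rfl))))).trans
      (reachableIn_of_adj (Step.cc ..).adj.symm (.inr (.inr (.inl rfl))) (.inr (.inr (.inr rfl))))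
  | 1, 2, _ => reachableIn_of_adj (Step.bb i (m + 1) h₁ h₂).adj.symm (.inl rfl) (.inr rfl)
  | 2, 0, _ => (hy.mono (Set.subset_insert _ _)).trans <| by
      have h := reachableIn_insert_colA (i := i) (one_le_two.trans h₀.1) h₀.2
      simp only [column_of_mem h₀] at h
      exact h
  | 2, 1, _ => (hy.mono (Set.subset_insert _ _)).trans <| by
      have h := reachableIn_insert_colC (i := i) (one_le_two.trans h₀.1) h₀.2
      simp only [column_of_mem h₀] at h
      exact h
  | 2, 2, h => by simp at h

end ladder

theorem not_isIncident_colB (E : PlaneEmbedding (windmillGraph p q)) {i i' : Fin p} {m j : ℕ}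
    (hm : 2 ≤ m) (hmq : m + 2 ≤ 2 * q) (hj : 1 ≤ j) (hjq : j ≤ 2 * q) (h : i' = i → j < m)
    {F : Set Plane} (hF : E.IsFace F) (hj' : E.IsIncident (colB i' j) F) :
    ¬ E.IsIncident (colB i (m + 1)) F := by
  have h₀ : m ∈ Set.Icc 2 (2 * q) := ⟨hm, by omega⟩
  have h₁ : m + 1 ∈ Set.Icc 2 (2 * q) := ⟨by omega, by omega⟩
  have h₂ : m + 2 ∈ Set.Icc 2 (2 * q) := ⟨by omega, hmq⟩
  simp only [column_of_mem h₁]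
  exact E.not_isIncident_of_K33
    ![b i ⟨m, h₀⟩, b i ⟨m + 2, h₂⟩, colB i' j] ![a i ⟨m, h₀⟩, c i ⟨m, h₀⟩, b i ⟨m + 1, h₁⟩]
    (ladderPath i h₀ h₁ h₂) (mem_ladderPath i h₀ h₁ h₂ (colB_mem_below h))
    (reachableIn_ladderPath i h₀ h₁ h₂ (reachableIn_below_z hj hjq h))
    (fun _ _ _ _ _ _ => disjoint_ladderPath i h₀ h₁ h₂) hF hj'

theorem mul_le_card_of_isFaceCover (E : PlaneEmbedding (windmillGraph p q))
    {R : Set (WindmillVertex p q)} (hR : ∀ i j, Odd j → 1 ≤ j → j ≤ 2 * q → colB i j ∈ R)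
    {C : Finset (Set Plane)} (hC : E.IsFaceCover R C) : p * (q - 1) ≤ C.card := by
  have hroot : ∀ x : Fin p × Fin (q - 1), ∃ F ∈ C, E.IsIncident (colB x.1 (2 * x.2 + 3)) F :=
    fun x => hC.2 _ (hR _ _ ⟨x.2 + 1, by ring⟩ (by omega) (by omega))
  choose f hfC hf using hroot
  have hlt : ∀ x y, (y.1 = x.1 → y.2 < x.2) → f x ≠ f y := fun x y hxy he =>
    not_isIncident_colB E (i := x.1) (i' := y.1) (m := 2 * x.2 + 2) (j := 2 * y.2 + 3)
      (by omega) (by omega) (by omega) (by omega) (fun h => by have := hxy h; omega)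
      (hC.1 _ (hfC x)) (he ▸ hf y) (hf x)
  have hinj : Function.Injective f := fun x y he => by
    by_contra hne
    by_cases h1 : y.1 = x.1
    · rcases lt_trichotomy x.2 y.2 with h | h | h
      · exact hlt y x (fun _ => h) he.symm
      · exact hne (Prod.ext h1.symm h)
      · exact hlt x y (fun _ => h) he
    · exact hlt x y (fun h => absurd h h1) he
  simpa only [Finset.card_univ, Fintype.card_prod, Fintype.card_fin] using
    Finset.card_le_card_of_injOn (s := Finset.univ) f (fun x _ => hfC x) hinj.injOn

end WindmillVertex

theorem colB_mem_windmillRoots {t : ℕ} (i : Fin (t / 2)) (j : ℕ) (hj : Odd j) (h1 : 1 ≤ j)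
    (h2 : j ≤ 2 * (t / 5)) : WindmillVertex.colB i j ∈ windmillRoots t :=
  ⟨i, ⟨j, h1, h2⟩, hj, (WindmillVertex.pathB_eq i ⟨j, h1, h2⟩).symm⟩

theorem sq_le_card_of_isFaceCover_windmillRoots {t : ℕ} (ht : 6 ≤ t) (hev : Even t)
    (E : PlaneEmbedding (windmill t)) {C : Finset (Set Plane)}
    (hC : E.IsFaceCover (windmillRoots t) C) : (1 / 100 : ℝ) * (t : ℝ) ^ 2 ≤ (C.card : ℝ) := by
  rcases lt_or_ge t 10 with h | h
  · obtain ⟨F, hF, -⟩ := hC.2 _ (colB_mem_windmillRoots ⟨0, by omega⟩ 1 odd_one le_rfl (by omega))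
    have hcard : (1 : ℝ) ≤ C.card := by exact_mod_cast Finset.card_pos.2 ⟨F, hF⟩
    have ht10 : (t : ℝ) < 10 := by exact_mod_cast h
    nlinarith
  · have hcover : t / 2 * (t / 5 - 1) ≤ C.card :=
      WindmillVertex.mul_le_card_of_isFaceCover E colB_mem_windmillRoots hC
    obtain ⟨k, rfl⟩ := hev
    obtain ⟨r, hr⟩ : ∃ r, (k + k) / 5 = r + 1 := ⟨(k + k) / 5 - 1, by omega⟩
    rw [hr, Nat.add_sub_cancel, show (k + k) / 2 = k by omega] at hcover
    have hkr : (k : ℝ) * r ≤ C.card := by exact_mod_cast hcover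
    have hk : (5 : ℝ) ≤ k := by exact_mod_cast (by omega : 5 ≤ k)
    have hr' : (2 * k : ℝ) ≤ 5 * r + 9 := by exact_mod_cast (by omega : 2 * k ≤ 5 * r + 9)
    push_cast
    nlinarith

/-! ### The windmill has no large rooted `K_{2,t}` minor -/

theorem finRotate_ne_self {p : ℕ} (hp : 2 ≤ p) (i : Fin p) : finRotate p i ≠ i := by
  obtain ⟨n, rfl⟩ := Nat.exists_eq_add_of_le' hp
  exact Equiv.Perm.mem_support.1 (support_finRotate ▸ Finset.mem_univ i)

namespace WindmillVertex

variable {p q : ℕ}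

/-- The vertices of the `i`-th vane other than `u i` and `u (i + 1)`. -/
def vane (i : Fin p) : Set (WindmillVertex p q) :=
  {x | match x with
    | v i' | a i' _ | b i' _ | c i' _ => i' = i
    | _ => False}

/-- The vertices of the `i`-th vane. -/
def closedVane (i : Fin p) : Set (WindmillVertex p q) :=
  {x | x ∈ vane i ∨ x = u i ∨ x = u (finRotate p i)}

section vane

variable {i i' k : Fin p} {x y : WindmillVertex p q}

theorem eq_of_mem_vane (h : x ∈ vane i) (h' : x ∈ vane i') : i = i' := by
  cases x with
  | z => exact h.elim
  | u => exact h.elim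
  | _ => exact Eq.trans (Eq.symm h) h'

theorem cases_vane (x : WindmillVertex p q) : x = z ∨ (∃ k, x = u k) ∨ ∃ i, x ∈ vane i := by
  cases x <;> simp [vane]

theorem eq_of_adj_of_mem_vane (h : (windmillGraph p q).Adj x y) (hx : x ∈ vane i)
    (hy : y ∉ vane i) : y = u i ∨ y = u (finRotate p i) ∨ (y = z ∧ x = v i) := by
  revert hx hy
  refine adj_induction (P := fun x y => x ∈ vane i → y ∉ vane i →
    y = u i ∨ y = u (finRotate p i) ∨ (y = z ∧ x = v i)) (fun x y hs => ?_) h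
  cases hs <;> simp [vane, -finRotate_apply] <;> grind

theorem exists_vane_of_adj_u (h : (windmillGraph p q).Adj (u k) y) :
    y = z ∨ ∃ i, (k = i ∨ k = finRotate p i) ∧ y ∈ vane i := by
  refine adj_induction (P := fun x y => x = u k →
    y = z ∨ ∃ i, (k = i ∨ k = finRotate p i) ∧ y ∈ vane i) (fun x y hs => ?_) h rfl
  cases hs <;> simp [vane, -finRotate_apply] <;> grind

theorem u_notMem_vane : (u k : WindmillVertex p q) ∉ vane i := not_false

theorem z_notMem_vane : (z : WindmillVertex p q) ∉ vane i := not_false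

theorem u_mem_closedVane (h : k = i ∨ k = finRotate p i) :
    (u k : WindmillVertex p q) ∈ closedVane i :=
  .inr (h.imp (congrArg u) (congrArg u))

theorem colB_mem_vane (i : Fin p) (j : ℕ) : (colB i j : WindmillVertex p q) ∈ vane i :=
  column_mem rfl fun _ _ => rfl

theorem mem_of_connected_of_mem_vane {S : Set (WindmillVertex p q)}
    (hS : ((windmillGraph p q).induce S).Connected) (hx : x ∈ S) (hxi : x ∈ vane i)
    (hSi : ¬ S ⊆ vane i) : u i ∈ S ∨ u (finRotate p i) ∈ S ∨ z ∈ S := by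
  obtain ⟨a, -, hai, b, hb, hbi, hab⟩ := exists_adj_notMem_of_connected hS hx hxi hSi
  rcases eq_of_adj_of_mem_vane hab hai hbi with rfl | rfl | ⟨rfl, -⟩
  exacts [.inl hb, .inr (.inl hb), .inr (.inr hb)]

end vane

/-- The set `X` joins the two ends `u i` and `u (i + 1)` of the `i`-th vane inside this vane. -/
def Crosses (X : Set (WindmillVertex p q)) (i : Fin p) : Prop :=
  u i ∈ X ∧ u (finRotate p i) ∈ X ∧
    ReachableIn (windmillGraph p q) (X ∩ closedVane i) (u i) (u (finRotate p i))

/-- The set `X` contains the outer two paths of the vane up to row `k` and, of the second path, the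
vertex in row `k`; so it separates the part of the second path below row `k` from the part of the
vane above it. The value `k = 2 * q + 1` is allowed and stands for both outer paths. -/
structure Encloses (X : Set (WindmillVertex p q)) (i : Fin p) (k : ℕ) : Prop where
  one_le : 1 ≤ k
  left : u i ∈ X
  right : u (finRotate p i) ∈ X
  a_mem : ∀ j : Set.Icc 2 (2 * q), (j : ℕ) ≤ k → a i j ∈ X
  c_mem : ∀ j : Set.Icc 2 (2 * q), (j : ℕ) ≤ k → c i j ∈ X
  b_mem : ∀ j : Set.Icc 2 (2 * q), (j : ℕ) = k → b i j ∈ X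
  v_mem : k = 1 → v i ∈ X

/-- The vertices of the second path of the `i`-th vane strictly between rows `m` and `k`. -/
def middle (i : Fin p) (m k : ℕ) : Set (WindmillVertex p q) :=
  {x | match x with
    | v i' => i' = i ∧ m < 1 ∧ 1 < k
    | b i' j => i' = i ∧ m < j ∧ (j : ℕ) < k
    | _ => False}

variable {X : Set (WindmillVertex p q)} {i : Fin p} {k m : ℕ} {x y : WindmillVertex p q}

theorem middle_subset_vane : (middle i m k : Set (WindmillVertex p q)) ⊆ vane i := by
  rintro (_ | _ | _ | _ | _ | _) h
  all_goals first | exact h.1 | exact h.elim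

theorem exists_eq_colB_of_mem_middle (h : x ∈ middle i m k) :
    ∃ l, m < l ∧ l < k ∧ x = colB i l ∧ ∀ m' < l, x ∈ middle i m' k := by
  cases x with
  | v i' =>
    obtain ⟨rfl, hm, hk⟩ := h
    exact ⟨1, hm, hk, column_one.symm, fun _ hm => ⟨rfl, hm, hk⟩⟩
  | b i' j =>
    obtain ⟨rfl, hm, hk⟩ := h
    exact ⟨j, hm, hk, (column_of_mem j.2).symm, fun _ hm => ⟨rfl, hm, hk⟩⟩
  | _ => exact h.elim

theorem Encloses.eq_of_adj (hX : Encloses X i k) (h : (windmillGraph p q).Adj x y)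
    (hx : x ∈ middle i m k) (hy : y ∉ middle i m k) (hyX : y ∉ X) :
    (m = 0 ∧ y = z) ∨ (1 ≤ m ∧ y = colB i m) := by
  obtain ⟨-, h1, h2, h3, h4, h5, -⟩ := hX
  revert hx hy hyX
  refine adj_induction (P := fun x y => x ∈ middle i m k → y ∉ middle i m k →
    y ∉ X → (m = 0 ∧ y = z) ∨ (1 ≤ m ∧ y = colB i m)) (fun x y hs => ?_) h
  cases hs <;> simp [middle, column, -finRotate_apply] <;> grind

theorem Encloses.mem_of_adj (hX : Encloses X i k) (h : (windmillGraph p q).Adj x y)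
    (hx : x ∈ vane i) (hx' : x ∉ middle i 0 k) (hxX : x ∉ X) (hyX : y ∉ X) :
    y ∈ vane i ∧ y ∉ middle i 0 k := by
  have hy : y ∉ middle i 0 k := fun hy => by
    rcases hX.eq_of_adj h.symm hy hx' hxX with ⟨-, rfl⟩ | ⟨h, -⟩
    exacts [z_notMem_vane hx, absurd h (Nat.not_succ_le_zero 0)]
  refine ⟨by_contra fun hyi => ?_, hy⟩
  rcases eq_of_adj_of_mem_vane h hx hyi with rfl | rfl | ⟨rfl, rfl⟩
  · exact hyX hX.left
  · exact hyX hX.right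
  · exact hx' ⟨rfl, one_pos, hX.one_le.lt_of_ne' fun h1 => hxX (hX.v_mem h1)⟩

section Crosses

variable (hp : 2 ≤ p) (hX : Crosses X i) (j : Set.Icc 2 (2 * q))
  (hB : ∀ m : ℕ, 1 ≤ m → m < j → colB i m ∉ X)

include hp hX hB

theorem Crosses.a_mem : a i j ∈ X := by
  obtain ⟨j, hj⟩ := j
  by_contra haX
  -- Inside the vane, `X` can leave this piece of the first path only through `a_{i,j}`.
  let T : Set (WindmillVertex p q) := {x | match x with
    | u i' => i' = i
    | a i' l => i' = i ∧ (l : ℕ) < j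
    | _ => False}
  have hrot := finRotate_ne_self hp i
  have hv : v i ∉ X := by simpa only [column_one] using hB 1 le_rfl hj.1
  have hb : ∀ l : Set.Icc 2 (2 * q), (l : ℕ) < j → b i l ∉ X := fun l hl => by
    simpa only [column_of_mem l.2] using hB l (one_le_two.trans l.2.1) hl
  obtain ⟨x, hxS, hxT, y, hyS, hyT, hxy⟩ := hX.2.2.exists_adj_notMem (T := T) rfl hrot
  revert hxS hxT hyS hyT
  refine adj_induction (P := fun x y => x ∈ X ∩ closedVane i → x ∈ T →
    y ∈ X ∩ closedVane i → y ∉ T → False) (fun x y hs => ?_) hxy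
  clear hB
  cases hs <;> simp [T, closedVane, vane, -finRotate_apply] <;> grind

theorem Crosses.c_mem : c i j ∈ X := by
  obtain ⟨j, hj⟩ := j
  by_contra hcX
  let T : Set (WindmillVertex p q) := {x | match x with
    | u i' => i' = finRotate p i
    | c i' l => i' = i ∧ (l : ℕ) < j
    | _ => False}
  have hrot := finRotate_ne_self hp i
  have hv : v i ∉ X := by simpa only [column_one] using hB 1 le_rfl hj.1
  have hb : ∀ l : Set.Icc 2 (2 * q), (l : ℕ) < j → b i l ∉ X := fun l hl => by
    simpa only [column_of_mem l.2] using hB l (one_le_two.trans l.2.1) hl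
  obtain ⟨x, hxS, hxT, y, hyS, hyT, hxy⟩ :=
    ReachableIn.exists_adj_notMem (T := T) hX.2.2.symm rfl hrot.symm
  revert hxS hxT hyS hyT
  refine adj_induction (P := fun x y => x ∈ X ∩ closedVane i → x ∈ T →
    y ∈ X ∩ closedVane i → y ∉ T → False) (fun x y hs => ?_) hxy
  clear hB
  cases hs <;> simp [T, closedVane, vane, -finRotate_apply] <;> grind

end Crosses

theorem Crosses.exists_encloses (hp : 2 ≤ p) (hq : 1 ≤ q) (hX : Crosses X i) :
    ∃ k, Encloses X i k := by
  classical
  have hex : ∃ k, 1 ≤ k ∧ (colB i k ∈ X ∨ 2 * q < k) := ⟨2 * q + 1, by omega, .inr (by omega)⟩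
  obtain ⟨k, ⟨hk1, hk⟩, hmin⟩ : ∃ k, (1 ≤ k ∧ (colB i k ∈ X ∨ 2 * q < k)) ∧
      ∀ m, 1 ≤ m → m < k → colB i m ∉ X :=
    ⟨Nat.find hex, Nat.find_spec hex, fun m h1 hm h => Nat.find_min hex hm ⟨h1, .inl h⟩⟩
  refine ⟨k, hk1, hX.1, hX.2.1,
    fun j hj => hX.a_mem hp j fun m h1 hm => hmin m h1 (hm.trans_le hj),
    fun j hj => hX.c_mem hp j fun m h1 hm => hmin m h1 (hm.trans_le hj), ?_, ?_⟩
  · rintro j rfl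
    simpa only [column_of_mem j.2] using hk.resolve_right j.2.2.not_gt
  · rintro rfl
    simpa only [column_one] using hk.resolve_right (by omega)

/-- The graph on the vertices `u k` in `X` in which consecutive ones are adjacent if `X` crosses the
vane between them. -/
def crossGraph (X : Set (WindmillVertex p q)) : SimpleGraph {k : Fin p // u k ∈ X} :=
  SimpleGraph.fromRel fun k l => Crosses X k ∧ (l : Fin p) = finRotate p k

theorem crossGraph_reachable {k l : Fin p} (hk : u k ∈ X) (hl : u l ∈ X)
    (hki : k = i ∨ k = finRotate p i) (hli : l = i ∨ l = finRotate p i)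
    (h : ReachableIn (windmillGraph p q) (X ∩ closedVane i) (u k) (u l)) :
    (crossGraph X).Reachable ⟨k, hk⟩ ⟨l, hl⟩ := by
  by_cases hkl : k = l
  · subst hkl; exact .refl _
  refine SimpleGraph.Adj.reachable ?_
  rw [crossGraph, SimpleGraph.fromRel_adj]
  refine ⟨fun h => hkl (congrArg Subtype.val h), ?_⟩
  rcases hki with rfl | rfl <;> rcases hli with rfl | rfl
  · exact absurd rfl hkl
  · exact .inl ⟨⟨hk, hl, h⟩, rfl⟩
  · exact .inr ⟨⟨hl, hk, h.symm⟩, rfl⟩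
  · exact absurd rfl hkl

theorem eq_u_of_adj_of_notMem_closedVane (h : (windmillGraph p q).Adj x y)
    (hx : x ∈ closedVane i) (hy : y ∉ closedVane i) (hyz : y ≠ z) :
    ∃ m, x = u m ∧ (m = i ∨ m = finRotate p i) := by
  rcases hx with hx | rfl | rfl
  · rcases eq_of_adj_of_mem_vane h hx (fun hy' => hy (.inl hy')) with h | h | h
    exacts [(hy (.inr (.inl h))).elim, (hy (.inr (.inr h))).elim, (hyz h.1).elim]
  · exact ⟨i, rfl, .inl rfl⟩
  · exact ⟨_, rfl, .inr rfl⟩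

theorem exists_crossGraph_reachable (hz : z ∉ X) {k₀ : Fin p} (hk₀ : u k₀ ∈ X)
    (hx : ReachableIn (windmillGraph p q) X (u k₀) x) :
    ∃ (k : Fin p) (hk : u k ∈ X) (i : Fin p), (k = i ∨ k = finRotate p i) ∧ x ∈ closedVane i ∧
      ReachableIn (windmillGraph p q) (X ∩ closedVane i) (u k) x ∧
      (crossGraph X).Reachable ⟨k₀, hk₀⟩ ⟨k, hk⟩ := by
  induction hx using ReachableIn.induction with
  | refl => exact ⟨k₀, hk₀, k₀, .inl rfl, u_mem_closedVane (.inl rfl), .refl _, .refl _⟩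
  | @tail x y _ hadj hxX hyX ih =>
    obtain ⟨k, hk, i, hki, hxi, hkx, hreach⟩ := ih
    by_cases hyi : y ∈ closedVane i
    · exact ⟨k, hk, i, hki, hyi,
        hkx.trans (reachableIn_of_adj hadj ⟨hxX, hxi⟩ ⟨hyX, hyi⟩), hreach⟩
    have hyz : y ≠ z := fun h => hz (h ▸ hyX)
    obtain ⟨m, rfl, hmi⟩ := eq_u_of_adj_of_notMem_closedVane hadj hxi hyi hyz
    obtain ⟨i', hmi', hyi'⟩ := (exists_vane_of_adj_u hadj).resolve_left hyz
    exact ⟨m, hxX, i', hmi', .inl hyi',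
      reachableIn_of_adj hadj ⟨hxX, u_mem_closedVane hmi'⟩ ⟨hyX, .inl hyi'⟩,
      hreach.trans (crossGraph_reachable hk hxX hki hmi hkx)⟩

theorem crossGraph_preconnected (hX : ((windmillGraph p q).induce X).Connected) (hz : z ∉ X) :
    (crossGraph X).Preconnected := by
  rintro ⟨k₀, hk₀⟩ ⟨l, hl⟩
  obtain ⟨k, hk, i, hki, hli, hkl, hreach⟩ :=
    exists_crossGraph_reachable hz hk₀ ((induce_connected_iff.1 hX).2 _ hk₀ _ hl)
  refine hreach.trans (crossGraph_reachable hk hl hki ?_ hkl)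
  rcases hli with h | h | h
  exacts [(u_notMem_vane h).elim, .inl (u.inj h), .inr (u.inj h)]

theorem card_edgeSet_crossGraph_le :
    Nat.card (crossGraph X).edgeSet ≤ Nat.card {k : Fin p // Crosses X k} := by
  have hf : ∀ e : (crossGraph X).edgeSet, ∃ k : {k : Fin p // Crosses X k},
      (e : Sym2 {k : Fin p // u k ∈ X}) = s(⟨k, k.2.1⟩, ⟨finRotate p k, k.2.2.1⟩) := by
    rintro ⟨⟨k, l⟩, -, ⟨hc, hkl⟩ | ⟨hc, hkl⟩⟩
    · exact ⟨⟨k, hc⟩, congrArg (fun l => s(k, l)) (Subtype.ext hkl)⟩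
    · exact ⟨⟨l, hc⟩, Sym2.eq_swap.trans (congrArg (fun k => s(l, k)) (Subtype.ext hkl))⟩
  choose f hf using hf
  exact Nat.card_le_card_of_injective f fun e e' h => Subtype.ext (by rw [hf e, hf e', h])

open Classical in
theorem card_u_le_card_crosses_add_one (hX : ((windmillGraph p q).induce X).Connected)
    (hz : z ∉ X) :
    ({k | u k ∈ X} : Finset (Fin p)).card ≤ ({k | Crosses X k} : Finset (Fin p)).card + 1 := by
  rw [← Fintype.card_subtype, ← Fintype.card_subtype, ← Nat.card_eq_fintype_card,
    ← Nat.card_eq_fintype_card]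
  rcases isEmpty_or_nonempty {k : Fin p // u k ∈ X} with h | h
  · rw [Nat.card_of_isEmpty]
    exact Nat.zero_le _
  have hconn : (crossGraph X).Connected := ⟨crossGraph_preconnected hX hz⟩
  exact hconn.card_vert_le_card_edgeSet_add_one.trans
    (Nat.add_le_add_right card_edgeSet_crossGraph_le 1)

open Classical in
theorem card_touched_not_crossed_le (hX : ((windmillGraph p q).induce X).Connected) (hz : z ∉ X) :
    ({k | (u k ∈ X ∨ u (finRotate p k) ∈ X) ∧ ¬ Crosses X k} : Finset (Fin p)).card ≤ 2 := by
  have h := card_u_le_card_crosses_add_one hX hz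
  set U : Finset (Fin p) := {k | u k ∈ X}
  set U' : Finset (Fin p) := {k | u (finRotate p k) ∈ X}
  set T : Finset (Fin p) := {k | Crosses X k}
  have hUU' : U'.card = U.card :=
    Finset.card_equiv (finRotate p) fun k => by simp only [U, U', Finset.mem_filter_univ]
  have hTU : T ⊆ U := Finset.monotone_filter_right _ fun _ _ hk => hk.1
  have hTU' : T ⊆ U' := Finset.monotone_filter_right _ fun _ _ hk => hk.2.1
  have hsub : ({k | (u k ∈ X ∨ u (finRotate p k) ∈ X) ∧ ¬ Crosses X k} : Finset (Fin p)) ⊆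
      (U \ T) ∪ (U' \ T) := fun k hk => by
    simp only [U, U', T, Finset.mem_union, Finset.mem_sdiff, Finset.mem_filter_univ] at hk ⊢
    tauto
  have hcard := (Finset.card_le_card hsub).trans (Finset.card_union_le _ _)
  rw [Finset.card_sdiff_of_subset hTU, Finset.card_sdiff_of_subset hTU'] at hcard
  omega

end WindmillVertex

namespace WindmillVertex

variable {p q : ℕ} {ι : Type*} {X X' : Set (WindmillVertex p q)}
  {Y : ι → Set (WindmillVertex p q)} {s : ι → Fin p} {r : ι → ℕ}

/-- The sets `X`, `X'` and `Y j` are the branch sets of a rooted `K_{2,ι}`-model, and the set `Y j`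
contains the root in row `r j` of the vane `s j`. -/
structure IsRootedModel (X X' : Set (WindmillVertex p q)) (Y : ι → Set (WindmillVertex p q))
    (s : ι → Fin p) (r : ι → ℕ) : Prop where
  connX : ((windmillGraph p q).induce X).Connected
  connX' : ((windmillGraph p q).induce X').Connected
  connY : ∀ j, ((windmillGraph p q).induce (Y j)).Connected
  disjXX' : Disjoint X X'
  disjX : ∀ j, Disjoint X (Y j)
  disjX' : ∀ j, Disjoint X' (Y j)
  disjY : ∀ j k, j ≠ k → Disjoint (Y j) (Y k)
  adjX : ∀ j, ∃ x ∈ X, ∃ y ∈ Y j, (windmillGraph p q).Adj x y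
  adjX' : ∀ j, ∃ x ∈ X', ∃ y ∈ Y j, (windmillGraph p q).Adj x y
  root_mem : ∀ j, colB (s j) (r j) ∈ Y j
  root_odd : ∀ j, Odd (r j)
  root_le : ∀ j, r j ≤ 2 * q

theorem exists_u_mem (hX : ((windmillGraph p q).induce X).Connected) (hz : z ∉ X)
    (hv : ∀ i, ¬ X ⊆ vane i) : ∃ k, u k ∈ X := by
  obtain ⟨x, hx⟩ := (induce_connected_iff.1 hX).1
  rcases cases_vane x with rfl | ⟨k, rfl⟩ | ⟨i, hi⟩
  · exact (hz hx).elim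
  · exact ⟨k, hx⟩
  · rcases mem_of_connected_of_mem_vane hX hx hi (hv i) with h | h | h
    exacts [⟨_, h⟩, ⟨_, h⟩, (hz h).elim]

namespace IsRootedModel

theorem symm (h : IsRootedModel X X' Y s r) : IsRootedModel X' X Y s r :=
  ⟨h.connX', h.connX, h.connY, h.disjXX'.symm, h.disjX', h.disjX, h.disjY, h.adjX', h.adjX,
    h.root_mem, h.root_odd, h.root_le⟩

theorem eq_of_mem (h : IsRootedModel X X' Y s r) {j k : ι} {x : WindmillVertex p q} (hj : x ∈ Y j)
    (hk : x ∈ Y k) : j = k :=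
  by_contra fun hjk => Set.disjoint_left.1 (h.disjY j k hjk) hj hk

theorem subset_vane (h : IsRootedModel X X' Y s r) {j : ι} (h1 : u (s j) ∉ Y j)
    (h2 : u (finRotate p (s j)) ∉ Y j) (hz : z ∉ Y j) : Y j ⊆ vane (s j) := by
  by_contra hsub
  rcases mem_of_connected_of_mem_vane (h.connY j) (h.root_mem j) (colB_mem_vane _ _) hsub
    with h' | h' | h'
  exacts [h1 h', h2 h', hz h']

theorem exists_end_mem (h : IsRootedModel X X' Y s r) (hz : z ∉ X') (hv : ∀ i, ¬ X' ⊆ vane i)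
    {j : ι} (hzj : z ∉ Y j) (h1 : u (s j) ∉ X') (h2 : u (finRotate p (s j)) ∉ X') :
    ∃ k, u k ∉ X' ∧ u k ∈ Y j := by
  by_contra! hno
  have hY := h.subset_vane (hno _ h1) (hno _ h2) hzj
  obtain ⟨x, hx, y, hy, hxy⟩ := h.adjX' j
  by_cases hxi : x ∈ vane (s j)
  · rcases mem_of_connected_of_mem_vane h.connX' hx hxi (hv _) with h' | h' | h'
    exacts [h1 h', h2 h', hz h']
  · rcases eq_of_adj_of_mem_vane hxy.symm (hY hy) hxi with rfl | rfl | ⟨rfl, -⟩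
    exacts [h1 hx, h2 hx, hz hx]

theorem subset_vane_of_crosses (h : IsRootedModel X X' Y s r) {j : ι} (hzj : z ∉ Y j)
    (hc : Crosses X' (s j)) : Y j ⊆ vane (s j) :=
  h.subset_vane (Set.disjoint_left.1 (h.disjX' j) hc.1)
    (Set.disjoint_left.1 (h.disjX' j) hc.2.1) hzj

theorem z_mem_of_crosses (h : IsRootedModel X X' Y s r) (hv : ∀ i, ¬ X ⊆ vane i)
    {j : ι} (hzj : z ∉ Y j) (hc : Crosses X' (s j)) : z ∈ X := by
  have hu (k) (hk : u k ∈ X') : u k ∉ X := Set.disjoint_right.1 h.disjXX' hk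
  obtain ⟨x, hx, y, hy, hxy⟩ := h.adjX j
  by_cases hxi : x ∈ vane (s j)
  · rcases mem_of_connected_of_mem_vane h.connX hx hxi (hv _) with h' | h' | h'
    exacts [(hu _ hc.1 h').elim, (hu _ hc.2.1 h').elim, h']
  · rcases eq_of_adj_of_mem_vane hxy.symm (h.subset_vane_of_crosses hzj hc hy) hxi with
      rfl | rfl | ⟨rfl, -⟩
    exacts [(hu _ hc.1 hx).elim, (hu _ hc.2.1 hx).elim, hx]

section Encloses

variable {i : Fin p} {j : ι} {k m m' : ℕ}

/-- Since `X` contains `z`, it cannot enter the part of the vane above the enclosing row. So the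
neighbour of `X` in `Y j` lies on the second path, below that row. -/
theorem exists_colB_mem (h : IsRootedModel X X' Y s r) (hX' : Encloses X' i k) (hz : z ∈ X)
    (hY : Y j ⊆ vane i) :
    ∃ m, 1 ≤ m ∧ colB i m ∈ Y j ∧ (∀ m' < m, (colB i m : WindmillVertex p q) ∈ middle i m' k) ∧
      ∃ x ∈ X, (windmillGraph p q).Adj x (colB i m) := by
  have hXX' {x} (hx : x ∈ X) : x ∉ X' := Set.disjoint_left.1 h.disjXX' hx
  have hYX' {x} (hx : x ∈ Y j) : x ∉ X' := Set.disjoint_right.1 (h.disjX' j) hx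
  have hX : ∀ x ∈ X, ¬ (x ∈ vane i ∧ x ∉ middle i 0 k) := fun x hx hxi => by
    obtain ⟨a, ha, hai, b, hb, hbi, hab⟩ := exists_adj_notMem_of_connected h.connX hx
      (T := {x | x ∈ vane i ∧ x ∉ middle i 0 k}) hxi (fun hsub => z_notMem_vane (hsub hz).1)
    exact hbi (hX'.mem_of_adj hab hai.1 hai.2 (hXX' ha) (hXX' hb))
  obtain ⟨x, hx, y, hy, hxy⟩ := h.adjX j
  have hym : y ∈ middle i 0 k := by
    by_contra hym
    exact hX x hx (hX'.mem_of_adj hxy.symm (hY hy) hym (hYX' hy) (hXX' hx))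
  obtain ⟨m, hm0, -, rfl, hmm⟩ := exists_eq_colB_of_mem_middle hym
  exact ⟨m, hm0, hy, hmm, x, hx, hxy⟩

/-- The vertex `colB i m` separates the part of the second path between rows `m` and `k` from `z`,
as long as `X'` is avoided. -/
theorem not_adj_colB_of_colB_mem (h : IsRootedModel X X' Y s r) (hX' : Encloses X' i k)
    (hz : z ∈ X) (hm : 1 ≤ m) (hmY : colB i m ∈ Y j)
    (hm' : (colB i m' : WindmillVertex p q) ∈ middle i m k) {x : WindmillVertex p q} (hx : x ∈ X) :
    ¬ (windmillGraph p q).Adj x (colB i m') := by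
  intro hadj
  have hXX' {x} (hx : x ∈ X) : x ∉ X' := Set.disjoint_left.1 h.disjXX' hx
  have hmX : colB i m ∉ X := Set.disjoint_right.1 (h.disjX j) hmY
  by_cases hxm : x ∈ middle i m k
  · obtain ⟨a, -, hai, b, hb, hbi, hab⟩ := exists_adj_notMem_of_connected h.connX hx hxm
      (fun hsub => z_notMem_vane (middle_subset_vane (hsub hz)))
    rcases hX'.eq_of_adj hab hai hbi (hXX' hb) with ⟨rfl, -⟩ | ⟨-, rfl⟩
    exacts [Nat.not_succ_le_zero 0 hm, hmX hb]
  · rcases hX'.eq_of_adj hadj.symm hm' hxm (hXX' hx) with ⟨rfl, -⟩ | ⟨-, rfl⟩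
    exacts [Nat.not_succ_le_zero 0 hm, hmX hx]

end Encloses

theorem eq_of_crosses (h : IsRootedModel X X' Y s r) (hp : 2 ≤ p) (hq : 1 ≤ q)
    (hv : ∀ i, ¬ X ⊆ vane i) {j j' : ι} (hzj : z ∉ Y j) (hzj' : z ∉ Y j')
    (hc : Crosses X' (s j)) (hjj' : s j' = s j) : j = j' := by
  have hz := h.z_mem_of_crosses hv hzj hc
  obtain ⟨k, hk⟩ := hc.exists_encloses hp hq
  have hY := h.subset_vane_of_crosses hzj hc
  have hY' := hjj' ▸ h.subset_vane_of_crosses hzj' (hjj' ▸ hc)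
  obtain ⟨m, hm1, hmY, hmm, x, hx, hxm⟩ := h.exists_colB_mem hk hz hY
  obtain ⟨m', hm1', hmY', hmm', x', hx', hxm'⟩ := h.exists_colB_mem hk hz hY'
  rcases lt_trichotomy m m' with hlt | rfl | hlt
  · exact (h.not_adj_colB_of_colB_mem hk hz hm1 hmY (hmm' m hlt) hx' hxm').elim
  · exact h.eq_of_mem hmY hmY'
  · exact (h.not_adj_colB_of_colB_mem hk hz hm1' hmY' (hmm m' hlt) hx hxm).elim

section card

variable [Fintype ι] (h : IsRootedModel X X' Y s r)

include h

open Classical in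
theorem card_filter_mem_le_one (x : WindmillVertex p q) :
    ({j | x ∈ Y j} : Finset ι).card ≤ 1 :=
  Finset.card_le_one.2 fun _ hj _ hk =>
    h.eq_of_mem (Finset.mem_filter.1 hj).2 (Finset.mem_filter.1 hk).2

open Classical in
theorem card_filter_vane_le (i : Fin p) : ({j | s j = i} : Finset ι).card ≤ q := by
  rw [← Finset.card_range q]
  refine Finset.card_le_card_of_injOn (fun j => r j / 2) (fun j _ => ?_) (fun j hj k hk hjk => ?_)
  · have hodd := Nat.odd_iff.1 (h.root_odd j)
    have hle := h.root_le j
    exact Finset.mem_coe.2 (Finset.mem_range.2 (show r j / 2 < q by omega))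
  · obtain rfl : s j = i := (Finset.mem_filter.1 hj).2
    have hs : s k = s j := (Finset.mem_filter.1 hk).2
    have hr : r k = r j := by
      have hodd := Nat.odd_iff.1 (h.root_odd j)
      have hodd' := Nat.odd_iff.1 (h.root_odd k)
      simp only at hjk
      omega
    exact h.eq_of_mem (h.root_mem j) (hs ▸ hr ▸ h.root_mem k)

open Classical in
theorem card_le_of_subset_vane {i : Fin p} (hX : X ⊆ vane i) : Fintype.card ι ≤ q + 3 := by
  have hcases : ∀ j, s j = i ∨ u i ∈ Y j ∨ u (finRotate p i) ∈ Y j ∨ z ∈ Y j := fun j => by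
    by_contra! ⟨hs, h1, h2, h3⟩
    obtain ⟨x, hx, y, hy, hxy⟩ := h.adjX j
    have hyi : y ∈ vane i := by
      by_contra hyi
      rcases eq_of_adj_of_mem_vane hxy (hX hx) hyi with rfl | rfl | ⟨rfl, -⟩
      exacts [h1 hy, h2 hy, h3 hy]
    have hsub : ¬ Y j ⊆ vane i := fun hsub =>
      hs (eq_of_mem_vane (colB_mem_vane _ _) (hsub (h.root_mem j)))
    rcases mem_of_connected_of_mem_vane (h.connY j) hy hyi hsub with h' | h' | h'
    exacts [h1 h', h2 h', h3 h']
  calc Fintype.card ι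
      = (({j | s j = i} : Finset ι) ∪ (({j | u i ∈ Y j} : Finset ι) ∪
          (({j | u (finRotate p i) ∈ Y j} : Finset ι) ∪ ({j | z ∈ Y j} : Finset ι)))).card := by
        rw [← Finset.card_univ]
        congr 1
        ext j
        simpa only [Finset.mem_univ, Finset.mem_union, Finset.mem_filter_univ, true_iff]
          using hcases j
    _ ≤ q + (1 + (1 + 1)) := by
        refine (Finset.card_union_le _ _).trans (Nat.add_le_add (h.card_filter_vane_le i) ?_)
        refine (Finset.card_union_le _ _).trans (Nat.add_le_add (h.card_filter_mem_le_one _) ?_)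
        exact (Finset.card_union_le _ _).trans
          (Nat.add_le_add (h.card_filter_mem_le_one _) (h.card_filter_mem_le_one _))

open Classical in
theorem card_filter_z_mem_or_crosses_le (hp : 2 ≤ p) (hq : 1 ≤ q) (hz : z ∉ X')
    (hv : ∀ i, ¬ X ⊆ vane i) (hv' : ∀ i, ¬ X' ⊆ vane i) :
    ({j | z ∈ Y j ∨ Crosses X' (s j)} : Finset ι).card ≤
      ({k | u k ∈ X'} : Finset (Fin p)).card := by
  by_cases hex : ∃ j, z ∈ Y j
  · obtain ⟨j, hj⟩ := hex
    obtain ⟨k, hk⟩ := exists_u_mem h.connX' hz hv'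
    refine (Finset.card_le_one.2 fun l hl l' hl' => ?_).trans
      (Finset.card_pos.2 ⟨k, Finset.mem_filter.2 ⟨Finset.mem_univ _, hk⟩⟩)
    have heq : ∀ l, z ∈ Y l ∨ Crosses X' (s l) → l = j := fun l hl => by
      by_contra hlj
      have hzl : z ∉ Y l := fun hzl => hlj (h.eq_of_mem hzl hj)
      exact Set.disjoint_left.1 (h.disjX j)
        (h.z_mem_of_crosses hv hzl (hl.resolve_left hzl)) hj
    rw [heq l (Finset.mem_filter.1 hl).2, heq l' (Finset.mem_filter.1 hl').2]
  · push Not at hex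
    have hc : ∀ {j}, j ∈ ({j | z ∈ Y j ∨ Crosses X' (s j)} : Finset ι) → Crosses X' (s j) :=
      fun {j} hj => (Finset.mem_filter.1 hj).2.resolve_left (hex j)
    exact Finset.card_le_card_of_injOn s
      (fun j hj => Finset.mem_filter.2 ⟨Finset.mem_univ _, (hc hj).1⟩)
      fun j hj j' _ hjj' => h.eq_of_crosses hp hq hv (hex j) (hex j') (hc hj) hjj'.symm

open Classical in
theorem card_filter_touched_not_crossed_le (hz : z ∉ X') :
    ({j | (u (s j) ∈ X' ∨ u (finRotate p (s j)) ∈ X') ∧ ¬ Crosses X' (s j)} : Finset ι).card ≤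
      2 * q := by
  set D : Finset (Fin p) := {k | (u k ∈ X' ∨ u (finRotate p k) ∈ X') ∧ ¬ Crosses X' k}
  have hD {j} (hj : (u (s j) ∈ X' ∨ u (finRotate p (s j)) ∈ X') ∧ ¬ Crosses X' (s j)) : s j ∈ D :=
    Finset.mem_filter.2 ⟨Finset.mem_univ _, hj⟩
  calc _ ≤ q * D.card := Finset.card_le_mul_card_image_of_maps_to (f := s)
          (fun j hj => hD (Finset.mem_filter.1 hj).2) q
          fun i _ => (Finset.card_le_card (Finset.filter_subset_filter _
            (Finset.subset_univ _))).trans (h.card_filter_vane_le i)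
    _ ≤ q * 2 := Nat.mul_le_mul_left q (card_touched_not_crossed_le h.connX' hz)
    _ = 2 * q := mul_comm q 2

open Classical in
theorem card_filter_untouched_le (hz : z ∉ X') (hv' : ∀ i, ¬ X' ⊆ vane i) :
    ({j | z ∉ Y j ∧ u (s j) ∉ X' ∧ u (finRotate p (s j)) ∉ X'} : Finset ι).card ≤
      ({k | u k ∉ X'} : Finset (Fin p)).card := by
  refine Finset.card_le_card_of_forall_subsingleton (fun j k => u k ∈ Y j) (fun j hj => ?_)
    fun k _ j hj j' hj' => h.eq_of_mem hj.2 hj'.2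
  obtain ⟨hzj, h1, h2⟩ := (Finset.mem_filter.1 hj).2
  obtain ⟨k, hk, hkj⟩ := h.exists_end_mem hz hv' hzj h1 h2
  exact ⟨k, Finset.mem_filter.2 ⟨Finset.mem_univ _, hk⟩, hkj⟩

open Classical in
theorem card_le_of_z_notMem (hp : 2 ≤ p) (hq : 1 ≤ q) (hz : z ∉ X') (hv : ∀ i, ¬ X ⊆ vane i)
    (hv' : ∀ i, ¬ X' ⊆ vane i) : Fintype.card ι ≤ p + 2 * q := by
  have hcover : (Finset.univ : Finset ι) ⊆ (({j | z ∈ Y j ∨ Crosses X' (s j)} : Finset ι) ∪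
      ({j | z ∉ Y j ∧ u (s j) ∉ X' ∧ u (finRotate p (s j)) ∉ X'} : Finset ι)) ∪
      ({j | (u (s j) ∈ X' ∨ u (finRotate p (s j)) ∈ X') ∧ ¬ Crosses X' (s j)} : Finset ι) :=
    fun j _ => by
      simp only [Finset.mem_union, Finset.mem_filter_univ]
      tauto
  have hUN : ({k | u k ∈ X'} : Finset (Fin p)).card + ({k | u k ∉ X'} : Finset (Fin p)).card = p :=
    (Finset.card_filter_add_card_filter_not _).trans (Finset.card_fin p)
  calc Fintype.card ι
      ≤ _ := Finset.card_le_card hcover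
    _ ≤ _ := (Finset.card_union_le _ _).trans (Nat.add_le_add_right (Finset.card_union_le _ _) _)
    _ ≤ _ := Nat.add_le_add (Nat.add_le_add (h.card_filter_z_mem_or_crosses_le hp hq hz hv hv')
        (h.card_filter_untouched_le hz hv')) (h.card_filter_touched_not_crossed_le hz)
    _ = p + 2 * q := by rw [hUN]

end card

theorem card_lt [Fintype ι] (h : IsRootedModel X X' Y s r) (hp : 3 ≤ p) (hq : 1 ≤ q)
    (hpq : 5 * q ≤ 2 * p) : Fintype.card ι < 2 * p := by
  by_cases hv : ∃ i, X ⊆ vane i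
  · obtain ⟨i, hi⟩ := hv
    have := h.card_le_of_subset_vane hi
    omega
  by_cases hv' : ∃ i, X' ⊆ vane i
  · obtain ⟨i, hi⟩ := hv'
    have := h.symm.card_le_of_subset_vane hi
    omega
  push Not at hv hv'
  by_cases hz : z ∈ X'
  · have := h.symm.card_le_of_z_notMem (by omega) hq (Set.disjoint_right.1 h.disjXX' hz) hv' hv
    omega
  · have := h.card_le_of_z_notMem (by omega) hq hz hv hv'
    omega

end IsRootedModel

end WindmillVertex

theorem not_hasRootedK2Minor_windmill {t : ℕ} (ht : 6 ≤ t) (hev : Even t) :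
    ¬ HasRootedK2Minor (windmill t) (windmillRoots t) t := by
  rintro ⟨M, hM, hroot⟩
  choose x hx hxM using hroot
  choose s r hr hxr using hx
  have hmodel : WindmillVertex.IsRootedModel (M (.inl 0)) (M (.inl 1)) (fun j => M (.inr j))
      s (fun j => r j) :=
    { connX := hM.connected _
      connX' := hM.connected _
      connY := fun j => hM.connected _
      disjXX' := hM.disjoint _ _ (Sum.inl_injective.ne zero_ne_one)
      disjX := fun j => hM.disjoint _ _ Sum.inl_ne_inr
      disjX' := fun j => hM.disjoint _ _ Sum.inl_ne_inr
      disjY := fun j k hjk => hM.disjoint _ _ (Sum.inr_injective.ne hjk)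
      adjX := fun j => hM.edge _ _ (.inl ⟨rfl, rfl⟩)
      adjX' := fun j => hM.edge _ _ (.inl ⟨rfl, rfl⟩)
      root_mem := fun j => by
        rw [← WindmillVertex.pathB_eq, ← hxr j]
        exact hxM j
      root_odd := hr
      root_le := fun j => (r j).2.2 }
  obtain ⟨k, rfl⟩ := hev
  have hcard := hmodel.card_lt (by omega) (by omega) (by omega)
  rw [Fintype.card_fin] at hcard
  omega

/-! ### The windmill is 3-connected -/

section Fan

variable {V : Type*} {G : SimpleGraph V} {X : Finset V} {x r : V} {f g h : ℕ → V} {j n : ℕ}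

theorem exists_disjoint_of_card_lt {ι : Type*} [Fintype ι] {P : ι → Set V}
    (hX : X.card < Fintype.card ι) (hP : Pairwise (Function.onFun Disjoint P)) :
    ∃ i, Disjoint (P i) (X : Set V) := by
  by_contra! hmeet
  simp only [Set.not_disjoint_iff] at hmeet
  choose e heP heX using hmeet
  have hinj : Function.Injective e := fun i k hik => by
    by_contra hne
    exact Set.disjoint_left.1 (hP hne) (heP i) (hik ▸ heP k)
  exact hX.not_ge (Finset.card_le_card_of_injOn e (fun i _ => heX i) hinj.injOn)

theorem exists_reachableIn_compl_of_fan {P₁ P₂ P₃ : Set V} {w₁ w₂ w₃ : V} (hX : X.card < 3)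
    (hx : x ∉ X) (h₁₂ : Disjoint P₁ P₂) (h₁₃ : Disjoint P₁ P₃) (h₂₃ : Disjoint P₂ P₃)
    (hw₁ : w₁ ∈ P₁) (hw₂ : w₂ ∈ P₂) (hw₃ : w₃ ∈ P₃) (h₁ : ReachableIn G (insert x P₁) x w₁)
    (h₂ : ReachableIn G (insert x P₂) x w₂) (h₃ : ReachableIn G (insert x P₃) x w₃) :
    ∃ w ∈ ({w₁, w₂, w₃} : Set V), w ∉ X ∧ ReachableIn G (X : Set V)ᶜ x w := by
  have of_disjoint {P : Set V} {w : V} (hP : Disjoint P X) (hw : w ∈ P)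
      (hxw : ReachableIn G (insert x P) x w) : w ∉ X ∧ ReachableIn G (X : Set V)ᶜ x w :=
    ⟨Set.disjoint_left.1 hP hw, hxw.mono (Set.insert_subset hx hP.subset_compl_right)⟩
  have hP : Pairwise (Function.onFun Disjoint ![P₁, P₂, P₃]) := by
    rw [pairwise_disjoint_on]
    intro i k hik
    fin_cases i <;> fin_cases k <;> first | exact absurd hik (by decide) | assumption
  obtain ⟨i, hi⟩ := exists_disjoint_of_card_lt (by simpa only [Fintype.card_fin] using hX) hP
  fin_cases i
  · exact ⟨w₁, .inl rfl, of_disjoint hi hw₁ h₁⟩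
  · exact ⟨w₂, .inr (.inl rfl), of_disjoint hi hw₂ h₂⟩
  · exact ⟨w₃, .inr (.inr rfl), of_disjoint hi hw₃ h₃⟩

theorem reachableIn_insert_image_Icc (hf : ∀ k, 1 ≤ k → k + 1 ≤ n → G.Adj (f k) (f (k + 1)))
    (hj : 1 ≤ j) (hjn : j ≤ n) (hadj : G.Adj x (f j)) :
    ReachableIn G (insert x (f '' Set.Icc 1 j)) x (f 1) :=
  (reachableIn_of_adj hadj (.inl rfl) (.inr ⟨j, ⟨hj, le_rfl⟩, rfl⟩)).trans
    (reachableIn_of_chain hj (fun k h1 h2 => hf k h1 (h2.trans_le hjn))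
      fun k h1 h2 => .inr ⟨k, ⟨h1, h2⟩, rfl⟩).symm

theorem exists_reachableIn_of_mem_middle_path
    (hf : ∀ k, 1 ≤ k → k + 1 ≤ n → G.Adj (f k) (f (k + 1)))
    (hg : ∀ k, 1 ≤ k → k + 1 ≤ n → G.Adj (g k) (g (k + 1)))
    (hh : ∀ k, 1 ≤ k → k + 1 ≤ n → G.Adj (h k) (h (k + 1)))
    (hgf : G.Adj (g j) (f j)) (hgh : G.Adj (g j) (h j)) (hfg : ∀ k l, f k ≠ g l)
    (hfh : ∀ k l, f k ≠ h l) (hgh' : ∀ k l, g k ≠ h l) (hX : X.card < 3) (hj : 2 ≤ j)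
    (hjn : j ≤ n) (hx : g j ∉ X) :
    ∃ w ∈ ({f 1, g 1, h 1} : Set V), w ∉ X ∧ ReachableIn G (X : Set V)ᶜ (g j) w := by
  have hmem (f : ℕ → V) {k : ℕ} (hk : 1 ≤ k) : f 1 ∈ f '' Set.Icc 1 k := ⟨1, ⟨le_rfl, hk⟩, rfl⟩
  have hdown : G.Adj (g j) (g (j - 1)) := by
    obtain ⟨k, rfl⟩ := Nat.exists_eq_add_of_le' (one_le_two.trans hj)
    exact (hg k (by omega) hjn).symm
  exact exists_reachableIn_compl_of_fan hX hx
    (Set.disjoint_image_image fun k _ l _ => hfg k l)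
    (Set.disjoint_image_image fun k _ l _ => hfh k l)
    (Set.disjoint_image_image fun k _ l _ => hgh' k l)
    (hmem f (by omega)) (hmem g (by omega)) (hmem h (by omega))
    (reachableIn_insert_image_Icc hf (by omega) hjn hgf)
    (reachableIn_insert_image_Icc hg (by omega) (by omega) hdown)
    (reachableIn_insert_image_Icc hh (by omega) hjn hgh)

theorem exists_reachableIn_of_mem_outer_path
    (hf : ∀ k, 1 ≤ k → k + 1 ≤ n → G.Adj (f k) (f (k + 1)))
    (hg : ∀ k, 1 ≤ k → k + 1 ≤ n → G.Adj (g k) (g (k + 1)))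
    (hh : ∀ k, 1 ≤ k → k + 1 ≤ n → G.Adj (h k) (h (k + 1)))
    (hfg : G.Adj (f j) (g j)) (hfh : G.Adj (f n) (h n)) (hinj : Set.InjOn f (Set.Icc 1 n))
    (hfg' : ∀ k l, f k ≠ g l) (hfh' : ∀ k l, f k ≠ h l) (hgh' : ∀ k l, g k ≠ h l)
    (hX : X.card < 3) (hj : 2 ≤ j) (hjn : j ≤ n) (hx : f j ∉ X) :
    ∃ w ∈ ({f 1, g 1, h 1} : Set V), w ∉ X ∧ ReachableIn G (X : Set V)ᶜ (f j) w := by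
  have hmem (f : ℕ → V) {k : ℕ} (hk : 1 ≤ k) : f 1 ∈ f '' Set.Icc 1 k := ⟨1, ⟨le_rfl, hk⟩, rfl⟩
  have hdown : G.Adj (f j) (f (j - 1)) := by
    obtain ⟨k, rfl⟩ := Nat.exists_eq_add_of_le' (one_le_two.trans hj)
    exact (hf k (by omega) hjn).symm
  have hup : ReachableIn G (insert (f j) (f '' Set.Icc (j + 1) n ∪ h '' Set.Icc 1 n))
      (f j) (h 1) := by
    have hmemf : ∀ k, j ≤ k → k ≤ n →
        f k ∈ insert (f j) (f '' Set.Icc (j + 1) n ∪ h '' Set.Icc 1 n) := fun k h1 h2 =>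
      h1.eq_or_lt.imp (fun h => congrArg f h.symm) fun h => .inl ⟨k, ⟨h, h2⟩, rfl⟩
    exact ((reachableIn_of_chain hjn (fun k h1 h2 => hf k (by omega) h2) hmemf).trans
      (reachableIn_of_adj hfh (hmemf n hjn le_rfl)
        (.inr (.inr ⟨n, ⟨by omega, le_rfl⟩, rfl⟩)))).trans
      (reachableIn_of_chain (by omega) (fun k h1 h2 => hh k h1 h2)
        fun k h1 h2 => .inr (.inr ⟨k, ⟨h1, h2⟩, rfl⟩)).symm
  have htip : Disjoint (f '' Set.Icc 1 (j - 1)) (f '' Set.Icc (j + 1) n) := by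
    refine Set.disjoint_image_image fun k hk l hl hkl => ?_
    have := hinj ⟨hk.1, by have := hk.2; omega⟩ ⟨by have := hl.1; omega, hl.2⟩ hkl
    have := hk.2
    have := hl.1
    omega
  exact exists_reachableIn_compl_of_fan hX hx
    (Set.disjoint_image_image fun k _ l _ => hfg' k l)
    (Set.disjoint_union_right.2 ⟨htip, Set.disjoint_image_image fun k _ l _ => hfh' k l⟩)
    (Set.disjoint_union_right.2 ⟨Set.disjoint_image_image fun k _ l _ => (hfg' l k).symm,
      Set.disjoint_image_image fun k _ l _ => hgh' k l⟩)
    (hmem f (by omega)) (hmem g (by omega)) (.inr (hmem h (by omega)))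
    (reachableIn_insert_image_Icc hf (by omega) (by omega) hdown)
    (reachableIn_insert_image_Icc hg (by omega) hjn hfg) hup

theorem reachableIn_range_diff_singleton (hn : 0 < n) (hf : ∀ k, G.Adj (f k) (f (k + 1)))
    (hper : Function.Periodic f n) (hinj : ∀ k l, k < l → l < k + n → f l ≠ f k) {y : V}
    (hx : x ∈ Set.range f \ {r}) (hy : y ∈ Set.range f \ {r}) :
    ReachableIn G (Set.range f \ {r}) x y := by
  suffices ∃ m, ∀ w ∈ Set.range f \ {r}, ReachableIn G (Set.range f \ {r}) (f m) w by
    obtain ⟨m, hm⟩ := this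
    exact (hm x hx).symm.trans (hm y hy)
  by_cases hr : r ∈ Set.range f
  · obtain ⟨m, rfl⟩ := hr
    refine ⟨m + 1, fun w ⟨⟨k, hk⟩, hwm⟩ => ?_⟩
    have hex : ∃ k, m < k ∧ f k = w :=
      ⟨k + (m + 1) * n, by nlinarith, (hper.nat_mul (m + 1) k).trans hk⟩
    classical
    obtain ⟨hml, hlw⟩ := Nat.find_spec hex
    set l := Nat.find hex
    have hlt : l < m + n := by
      by_contra! hle
      obtain ⟨l', hl'⟩ := Nat.exists_eq_add_of_le' (le_of_add_le_right hle)
      have hl'w : f l' = w := by rw [← hlw, hl', hper]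
      have hml' : m ≠ l' := by
        rintro rfl
        exact hwm hl'w.symm
      exact Nat.find_min hex (m := l') (by omega) ⟨by omega, hl'w⟩
    rw [← hlw]
    exact reachableIn_of_chain hml (fun i _ _ => hf i)
      fun i h1 h2 => ⟨⟨i, rfl⟩, hinj m i h1 (by omega)⟩
  · refine ⟨0, fun w ⟨⟨k, hk⟩, _⟩ => hk ▸ ?_⟩
    exact reachableIn_of_chain k.zero_le (fun i _ _ => hf i)
      fun i _ _ => ⟨⟨i, rfl⟩, fun hi => hr ⟨i, hi⟩⟩

end Fan

namespace WindmillVertex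

variable {p q : ℕ}

theorem injOn_column {x : WindmillVertex p q} {f : Set.Icc 2 (2 * q) → WindmillVertex p q}
    (hf : Function.Injective f) (hx : ∀ j, f j ≠ x) :
    Set.InjOn (column x f) (Set.Icc 1 (2 * q)) := by
  intro j hj k hk hjk
  unfold column at hjk
  split_ifs at hjk with h2j h2k h2k
  · exact congrArg Subtype.val (hf hjk)
  · exact (hx _ hjk).elim
  · exact (hx _ hjk.symm).elim
  · simp only [Set.mem_Icc, not_and_or, not_le] at hj hk h2j h2k
    omega

theorem column_ne_column {x y : WindmillVertex p q}
    {f g : Set.Icc 2 (2 * q) → WindmillVertex p q} (hxy : x ≠ y) (hxg : ∀ k, x ≠ g k)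
    (hfy : ∀ j, f j ≠ y) (hfg : ∀ j k, f j ≠ g k) (j k : ℕ) : column x f j ≠ column y g k :=
  column_mem (S := {w | w ≠ column y g k})
    (column_mem (S := {w | x ≠ w}) hxy fun k _ => hxg k)
    fun j _ => column_mem (S := {w | f j ≠ w}) (hfy j) fun k _ => hfg j k

/-- The initial cycle of the windmill. -/
def rim : Set (WindmillVertex p q) := Set.range u ∪ Set.range v

theorem adj_z_of_mem_rim {w : WindmillVertex p q} (hw : w ∈ rim) :
    (windmillGraph p q).Adj z w := by
  rcases hw with ⟨i, rfl⟩ | ⟨i, rfl⟩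
  exacts [(Step.zu i).adj, (Step.zv i).adj]

theorem colA_ne_colB (i : Fin p) (j k : ℕ) : colA i j ≠ (colB i k : WindmillVertex p q) :=
  column_ne_column (by simp) (by simp) (by simp) (by simp) j k

theorem colB_ne_colC (i : Fin p) (j k : ℕ) : colB i j ≠ (colC i k : WindmillVertex p q) :=
  column_ne_column (by simp) (by simp) (by simp) (by simp) j k

theorem colA_ne_colC (hp : 2 ≤ p) (i : Fin p) (j k : ℕ) :
    colA i j ≠ (colC i k : WindmillVertex p q) :=
  column_ne_column (fun h => finRotate_ne_self hp i (u.inj h).symm) (by simp) (by simp) (by simp)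
    j k

section Deletion

variable {X : Finset (WindmillVertex p q)}

theorem exists_mem_rim_of_col {i : Fin p} {j : ℕ} {x : WindmillVertex p q} (hp : 2 ≤ p)
    (hX : X.card < 3) (hj : j ∈ Set.Icc 2 (2 * q)) (hx : x ∉ X)
    (hxj : x = colA i j ∨ x = colB i j ∨ x = colC i j) :
    ∃ w ∈ rim, w ∉ X ∧ ReachableIn (windmillGraph p q) (X : Set (WindmillVertex p q))ᶜ x w := by
  suffices ∃ w ∈ ({colA i 1, colB i 1, colC i 1} : Set (WindmillVertex p q)), w ∉ X ∧
      ReachableIn (windmillGraph p q) (X : Set (WindmillVertex p q))ᶜ x w by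
    obtain ⟨w, hw, h⟩ := this
    simp only [column_one] at hw
    refine ⟨w, ?_, h⟩
    rcases hw with rfl | rfl | rfl
    exacts [.inl ⟨_, rfl⟩, .inr ⟨_, rfl⟩, .inl ⟨_, rfl⟩]
  have hA := fun k => adj_colA (q := q) i (j := k)
  have hB := fun k => adj_colB (q := q) i (j := k)
  have hC := fun k => adj_colC (q := q) i (j := k)
  have hab := adj_colA_colB (q := q) i hj
  have hbc := adj_colB_colC (q := q) i hj
  have hac := adj_colA_colC (q := q) i (by have := hj.1.trans hj.2; omega)
  rcases hxj with rfl | rfl | rfl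
  · exact exists_reachableIn_of_mem_outer_path hA hB hC hab hac
      (injOn_column (fun j k h => (a.inj h).2) (by simp)) (colA_ne_colB i) (colA_ne_colC hp i)
      (colB_ne_colC i) hX hj.1 hj.2 hx
  · exact exists_reachableIn_of_mem_middle_path hA hB hC hab.symm hbc (colA_ne_colB i)
      (colA_ne_colC hp i) (colB_ne_colC i) hX hj.1 hj.2 hx
  · obtain ⟨w, hw, h⟩ := exists_reachableIn_of_mem_outer_path hC hB hA hbc.symm hac.symm
      (injOn_column (fun j k h => (c.inj h).2) (by simp)) (fun k l => (colB_ne_colC i l k).symm)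
      (fun k l => (colA_ne_colC hp i l k).symm) (fun k l => (colA_ne_colB i l k).symm) hX hj.1 hj.2
      hx
    refine ⟨w, ?_, h⟩
    rcases hw with rfl | rfl | rfl
    exacts [.inr (.inr rfl), .inr (.inl rfl), .inl rfl]

theorem exists_mem_rim_of_notMem (hp : 3 ≤ p) (hX : X.card < 3) {x : WindmillVertex p q}
    (hx : x ∉ X) :
    ∃ w ∈ rim, w ∉ X ∧ ReachableIn (windmillGraph p q) (X : Set (WindmillVertex p q))ᶜ x w := by
  cases x with
  | u i => exact ⟨u i, .inl ⟨i, rfl⟩, hx, .refl _⟩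
  | v i => exact ⟨v i, .inr ⟨i, rfl⟩, hx, .refl _⟩
  | z =>
    obtain ⟨i, hi⟩ := exists_disjoint_of_card_lt (P := fun i : Fin p => {u i})
      (hX.trans_le (hp.trans_eq (Fintype.card_fin p).symm))
      (fun i k hik => Set.disjoint_singleton.2 fun h => hik (u.inj h))
    have hiX : u i ∉ X := Set.disjoint_singleton_left.1 hi
    exact ⟨u i, .inl ⟨i, rfl⟩, hiX, reachableIn_of_adj (Step.zu i).adj hx hiX⟩
  | a i j => exact exists_mem_rim_of_col (by omega) hX j.2 hx (.inl (column_of_mem j.2).symm)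
  | b i j => exact exists_mem_rim_of_col (by omega) hX j.2 hx (.inr (.inl (column_of_mem j.2).symm))
  | c i j => exact exists_mem_rim_of_col (by omega) hX j.2 hx (.inr (.inr (column_of_mem j.2).symm))

end Deletion

/-- The vertices of the initial cycle in cyclic order, as a periodic sequence. -/
def rimVertex (hp : 0 < p) (n : ℕ) : WindmillVertex p q :=
  if n % 2 = 0 then u ⟨n / 2 % p, Nat.mod_lt _ hp⟩ else v ⟨n / 2 % p, Nat.mod_lt _ hp⟩

theorem range_rimVertex (hp : 0 < p) :
    Set.range (rimVertex hp) = (rim : Set (WindmillVertex p q)) := by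
  ext x
  constructor
  · rintro ⟨n, rfl⟩
    unfold rimVertex
    split_ifs
    exacts [.inl ⟨_, rfl⟩, .inr ⟨_, rfl⟩]
  · rintro (⟨i, rfl⟩ | ⟨i, rfl⟩)
    · refine ⟨2 * i, ?_⟩
      simp only [rimVertex, Nat.mul_mod_right, if_true, Nat.mul_div_cancel_left _ Nat.two_pos,
        Nat.mod_eq_of_lt i.2]
    · refine ⟨2 * i + 1, ?_⟩
      have hmod : ¬ (2 * (i : ℕ) + 1) % 2 = 0 := by omega
      have hdiv : (2 * (i : ℕ) + 1) / 2 = i := by omega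
      simp only [rimVertex, if_neg hmod, hdiv, Nat.mod_eq_of_lt i.2]

theorem finRotate_mk_mod (hp : 0 < p) (n : ℕ) :
    finRotate p ⟨n % p, Nat.mod_lt _ hp⟩ = ⟨(n + 1) % p, Nat.mod_lt _ hp⟩ := by
  obtain ⟨k, rfl⟩ := Nat.exists_eq_add_of_le' hp
  rw [finRotate_apply]
  ext
  simp [Fin.val_add]

theorem adj_rimVertex (hp : 0 < p) (n : ℕ) :
    (windmillGraph p q).Adj (rimVertex hp n) (rimVertex hp (n + 1)) := by
  by_cases hn : n % 2 = 0
  · have hmod : ¬ (n + 1) % 2 = 0 := by omega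
    have hdiv : (n + 1) / 2 = n / 2 := by omega
    simp only [rimVertex, if_pos hn, if_neg hmod, hdiv]
    exact (Step.uv _).adj
  · have hmod : (n + 1) % 2 = 0 := by omega
    have hdiv : (n + 1) / 2 = n / 2 + 1 := by omega
    simp only [rimVertex, if_pos hmod, if_neg hn, hdiv]
    rw [← finRotate_mk_mod hp]
    exact (Step.vu _).adj

theorem periodic_rimVertex (hp : 0 < p) :
    Function.Periodic (rimVertex hp : ℕ → WindmillVertex p q) (2 * p) := fun n => by
  have hmod : (n + 2 * p) % 2 = n % 2 := by omega
  have hdiv : (n + 2 * p) / 2 = n / 2 + p := by omega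
  simp only [rimVertex, hmod, hdiv, Nat.add_mod_right]

theorem rimVertex_ne (hp : 0 < p) {m n : ℕ} (hmn : m < n) (hnm : n < m + 2 * p) :
    (rimVertex hp n : WindmillVertex p q) ≠ rimVertex hp m := by
  intro h
  have hmod : n % 2 = m % 2 ∧ n / 2 % p = m / 2 % p := by
    unfold rimVertex at h
    split_ifs at h <;> simp only [u.injEq, v.injEq, Fin.mk.injEq] at h <;> omega
  have hdvd : p ∣ n / 2 - m / 2 := Nat.dvd_of_mod_eq_zero (Nat.sub_mod_eq_zero_of_mod_eq hmod.2)
  have hle : p ≤ n / 2 - m / 2 := Nat.le_of_dvd (by omega) hdvd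
  omega

theorem reachableIn_rim_diff_singleton (hp : 0 < p) {r x y : WindmillVertex p q}
    (hx : x ∈ rim \ {r}) (hy : y ∈ rim \ {r}) :
    ReachableIn (windmillGraph p q) (rim \ {r}) x y := by
  rw [← range_rimVertex hp] at hx hy ⊢
  exact reachableIn_range_diff_singleton (by omega) (adj_rimVertex hp) (periodic_rimVertex hp)
    (fun _ _ => rimVertex_ne hp) hx hy

section Deletion

variable {X : Finset (WindmillVertex p q)}

theorem reachableIn_compl_of_mem_rim (hp : 0 < p) (hX : X.card < 3) {x y : WindmillVertex p q}
    (hx : x ∈ rim) (hy : y ∈ rim) (hxX : x ∉ X) (hyX : y ∉ X) :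
    ReachableIn (windmillGraph p q) (X : Set (WindmillVertex p q))ᶜ x y := by
  by_cases hz : z ∈ X
  · have hzrim : (z : WindmillVertex p q) ∉ rim := by rintro (⟨i, h⟩ | ⟨i, h⟩) <;> cases h
    have hne {w r : WindmillVertex p q} (hwX : w ∉ X) (hrX : r ∈ X) : w ≠ r := by
      rintro rfl
      exact hwX hrX
    obtain ⟨r, hrX, hrim⟩ : ∃ r ∈ X, ∀ w ∈ rim \ {r}, w ∉ X := by
      by_cases hmeet : ∃ r ∈ rim, r ∈ X
      · obtain ⟨r, hr, hrX⟩ := hmeet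
        refine ⟨r, hrX, fun w hw hwX => hX.not_ge (Finset.two_lt_card.2
          ⟨z, hz, r, hrX, w, hwX, ?_, ?_, Ne.symm hw.2⟩)⟩
        exacts [fun h => hzrim (h ▸ hr), fun h => hzrim (h ▸ hw.1)]
      · push Not at hmeet
        exact ⟨z, hz, fun w hw => hmeet w hw.1⟩
    exact (reachableIn_rim_diff_singleton hp ⟨hx, hne hxX hrX⟩ ⟨hy, hne hyX hrX⟩).mono hrim
  · exact (reachableIn_of_adj (adj_z_of_mem_rim hx).symm hxX hz).trans
      (reachableIn_of_adj (adj_z_of_mem_rim hy) hz hyX)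

end Deletion

theorem isVertexConnected_windmillGraph (hp : 3 ≤ p) :
    (windmillGraph p q).IsVertexConnected 3 := by
  have hcard : 3 < Nat.card (WindmillVertex p q) := by
    have hinj : Function.Injective (Sum.elim u v : Fin p ⊕ Fin p → WindmillVertex p q) :=
      Function.Injective.sumElim (fun _ _ => u.inj) (fun _ _ => v.inj) (by simp)
    have hle := Nat.card_le_card_of_injective _ hinj
    rw [Nat.card_sum, Nat.card_fin] at hle
    omega
  refine ⟨hcard, fun X hX => induce_connected_iff.2 ⟨?_, fun x hx y hy => ?_⟩⟩
  · by_contra hempty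
    rw [Set.not_nonempty_iff_eq_empty, Set.compl_empty_iff] at hempty
    have := Set.ncard_coe_finset X
    rw [hempty, Set.ncard_univ] at this
    omega
  · obtain ⟨w, hw, hwX, hxw⟩ := exists_mem_rim_of_notMem hp hX hx
    obtain ⟨w', hw', hwX', hyw'⟩ := exists_mem_rim_of_notMem hp hX hy
    exact (hxw.trans (reachableIn_compl_of_mem_rim (by omega) hX hw hw' hwX hwX')).trans hyw'.symm

end WindmillVertex

/-! ### Plane drawings by curves -/

/-- A drawing of `G` in the plane by parametrized curves: `curve e`, restricted to `[0, 1]`, joins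
the vertices `src e` and `tgt e`, and the open curves are injective and disjoint from each other and
from the vertices. Every edge of `G` is drawn, in one of its two directions. -/
structure CurveDrawing {V : Type*} (G : SimpleGraph V) (ι : Type*) where
  point : V → Plane
  src : ι → V
  tgt : ι → V
  curve : ι → ℝ → Plane
  point_injective : Function.Injective point
  continuous_curve : ∀ e, Continuous (curve e)
  curve_zero : ∀ e, curve e 0 = point (src e)
  curve_one : ∀ e, curve e 1 = point (tgt e)
  exists_of_adj : ∀ x y, G.Adj x y → ∃ e, s(src e, tgt e) = s(x, y)
  curve_ne_point : ∀ e, ∀ t ∈ Set.Ioo (0 : ℝ) 1, ∀ w, curve e t ≠ point w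
  eq_of_curve_eq : ∀ e e', ∀ t ∈ Set.Ioo (0 : ℝ) 1, ∀ t' ∈ Set.Ioo (0 : ℝ) 1,
    curve e t = curve e' t' → e = e' ∧ t = t'

namespace CurveDrawing

variable {V ι : Type*} {G : SimpleGraph V} (D : CurveDrawing G ι) {e e' : ι} {t t' : ℝ} {w : V}

theorem eq_endpoint_of_curve_eq_point (ht : t ∈ Set.Icc (0 : ℝ) 1) (h : D.curve e t = D.point w) :
    (t = 0 ∧ w = D.src e) ∨ (t = 1 ∧ w = D.tgt e) := by
  rcases ht.1.eq_or_lt with rfl | h0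
  · exact .inl ⟨rfl, D.point_injective (h.symm.trans (D.curve_zero e))⟩
  · rcases ht.2.eq_or_lt with rfl | h1
    · exact .inr ⟨rfl, D.point_injective (h.symm.trans (D.curve_one e))⟩
    · exact absurd h (D.curve_ne_point e t ⟨h0, h1⟩ w)

theorem curve_mem_range_point_or_mem_Ioo (e : ι) (ht : t ∈ Set.Icc (0 : ℝ) 1) :
    (∃ w, D.curve e t = D.point w) ∨ t ∈ Set.Ioo (0 : ℝ) 1 := by
  rcases ht.1.eq_or_lt with rfl | h0
  · exact .inl ⟨_, D.curve_zero e⟩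
  · rcases ht.2.eq_or_lt with rfl | h1
    exacts [.inl ⟨_, D.curve_one e⟩, .inr ⟨h0, h1⟩]

theorem exists_point_eq_of_curve_eq (hne : e ≠ e') (ht : t ∈ Set.Icc (0 : ℝ) 1)
    (ht' : t' ∈ Set.Icc (0 : ℝ) 1) (h : D.curve e t = D.curve e' t') :
    ∃ w, D.curve e t = D.point w := by
  rcases D.curve_mem_range_point_or_mem_Ioo e ht with hw | hmem
  · exact hw
  · rcases D.curve_mem_range_point_or_mem_Ioo e' ht' with ⟨w, hw⟩ | hmem'
    · exact ⟨w, h.trans hw⟩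
    · exact absurd (D.eq_of_curve_eq e e' t hmem t' hmem' h).1 hne

theorem injOn_curve (hne : D.src e ≠ D.tgt e) : Set.InjOn (D.curve e) (Set.Icc 0 1) := by
  have eq_of_point : ∀ t ∈ Set.Icc (0 : ℝ) 1, ∀ t' ∈ Set.Icc (0 : ℝ) 1, ∀ w,
      D.curve e t = D.point w → D.curve e t' = D.point w → t = t' := by
    intro t ht t' ht' w h h'
    rcases D.eq_endpoint_of_curve_eq_point ht h with ⟨rfl, rfl⟩ | ⟨rfl, rfl⟩ <;>
      rcases D.eq_endpoint_of_curve_eq_point ht' h' with ⟨rfl, hw⟩ | ⟨rfl, hw⟩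
    exacts [rfl, absurd hw hne, absurd hw.symm hne, rfl]
  intro t ht t' ht' h
  rcases D.curve_mem_range_point_or_mem_Ioo e ht with ⟨w, hw⟩ | hmem
  · exact eq_of_point t ht t' ht' w hw (h.symm.trans hw)
  · rcases D.curve_mem_range_point_or_mem_Ioo e ht' with ⟨w, hw⟩ | hmem'
    · exact eq_of_point t ht t' ht' w (h.trans hw) hw
    · exact (D.eq_of_curve_eq e e t hmem t' hmem' h).2

theorem exists_path_range_eq {x y : V} (hxy : x ≠ y) (he : s(D.src e, D.tgt e) = s(x, y)) :
    ∃ γ : Path (D.point x) (D.point y),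
      Function.Injective γ ∧ Set.range γ = D.curve e '' Set.Icc 0 1 := by
  let γ : Path (D.point (D.src e)) (D.point (D.tgt e)) :=
    ⟨⟨fun t => D.curve e t, (D.continuous_curve e).comp continuous_subtype_val⟩,
      D.curve_zero e, D.curve_one e⟩
  have hrange : Set.range γ = D.curve e '' Set.Icc 0 1 := (Set.image_eq_range _ _).symm
  have hinj (hne : D.src e ≠ D.tgt e) : Function.Injective γ :=
    fun t t' h => Subtype.ext (D.injOn_curve hne t.2 t'.2 h)
  rcases Sym2.eq_iff.1 he with ⟨rfl, rfl⟩ | ⟨rfl, rfl⟩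
  · exact ⟨γ, hinj hxy, hrange⟩
  · exact ⟨γ.symm, (hinj hxy.symm).comp unitInterval.symm_bijective.injective,
      γ.symm_range.trans hrange⟩

theorem nonempty_planeEmbedding (D : CurveDrawing G ι) : Nonempty (PlaneEmbedding G) := by
  have exists_index : ∀ e : G.edgeSet, ∃ k, s(D.src k, D.tgt k) = (e : Sym2 V) := by
    rintro ⟨⟨x, y⟩, hxy⟩
    exact D.exists_of_adj x y hxy
  choose κ hκ using exists_index
  have mem_of_curve_eq (e : G.edgeSet) {t : ℝ} (ht : t ∈ Set.Icc (0 : ℝ) 1) {w : V}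
      (h : D.curve (κ e) t = D.point w) : w ∈ (e : Sym2 V) := by
    rw [← hκ e, Sym2.mem_iff]
    exact (D.eq_endpoint_of_curve_eq_point ht h).imp And.right And.right
  refine ⟨{ point := D.point, arc := fun e => D.curve (κ e) '' Set.Icc 0 1,
            point_injective := D.point_injective,
            isArc := fun x y h => D.exists_path_range_eq (G.ne_of_adj h) (hκ _),
            mem_of_point_mem := ?_, arc_inter := ?_ }⟩
  · rintro e w ⟨t, ht, h⟩
    exact mem_of_curve_eq e ht h
  · rintro e e' hee' _ ⟨⟨t, ht, rfl⟩, ⟨t', ht', htt'⟩⟩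
    have hκne : κ e ≠ κ e' := fun h => hee' (Subtype.ext (by rw [← hκ e, ← hκ e', h]))
    obtain ⟨w, hw⟩ := D.exists_point_eq_of_curve_eq hκne ht ht' htt'.symm
    exact ⟨w, mem_of_curve_eq e ht hw, mem_of_curve_eq e' ht' (htt'.trans hw), hw⟩

end CurveDrawing

/-! ### Polar coordinates adapted to `p` sectors -/

/-- The point with polar coordinates `r` and `π * (2 * i + x) / p`: the plane is divided into `p`
equal sectors, and `x` runs from `0` to `2` in the `i`-th one. -/
noncomputable def polarPoint {p : ℕ} (i : Fin p) (x r : ℝ) : Plane :=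
  !₂[r * Real.cos (Real.pi * (2 * i + x) / p), r * Real.sin (Real.pi * (2 * i + x) / p)]

theorem eq_and_angle_eq_of_polar_eq {r r' α β : ℝ} (hr : 0 < r) (hr' : 0 ≤ r')
    (hcos : r * Real.cos α = r' * Real.cos β) (hsin : r * Real.sin α = r' * Real.sin β) :
    r = r' ∧ (α : Real.Angle) = β := by
  have hsq : r ^ 2 = r' ^ 2 := by
    calc r ^ 2 = (r * Real.sin α) ^ 2 + (r * Real.cos α) ^ 2 := by
          linear_combination -r ^ 2 * Real.sin_sq_add_cos_sq α
      _ = (r' * Real.sin β) ^ 2 + (r' * Real.cos β) ^ 2 := by rw [hsin, hcos]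
      _ = r' ^ 2 := by linear_combination r' ^ 2 * Real.sin_sq_add_cos_sq β
  obtain rfl : r = r' := (sq_eq_sq₀ hr.le hr').1 hsq
  exact ⟨rfl, Real.Angle.cos_sin_inj (mul_left_cancel₀ hr.ne' hcos) (mul_left_cancel₀ hr.ne' hsin)⟩

theorem nat_eq_of_cast_lt_add_one {m n : ℕ} (h : (m : ℝ) < n + 1) (h' : (n : ℝ) < m + 1) :
    m = n := by
  have hmn : m < n + 1 := by exact_mod_cast h
  have hnm : n < m + 1 := by exact_mod_cast h'
  omega

theorem sector_eq_of_angle_eq {p : ℕ} {i i' : Fin p} {x x' : ℝ} (hx : x ∈ Set.Ico (0 : ℝ) 2)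
    (hx' : x' ∈ Set.Ico (0 : ℝ) 2)
    (h : ((Real.pi * (2 * i + x) / p : ℝ) : Real.Angle) = (Real.pi * (2 * i' + x') / p : ℝ)) :
    i = i' ∧ x = x' := by
  obtain ⟨k, hk⟩ := Real.Angle.angle_eq_iff_two_pi_dvd_sub.1 h
  have hp : (0 : ℝ) < p := by exact_mod_cast i.pos
  have hturns : (2 * (i : ℝ) + x) - (2 * i' + x') = 2 * p * k := by
    have := Real.pi_pos
    field_simp at hk
    linear_combination hk
  have hi : (i : ℝ) + 1 ≤ p := by exact_mod_cast i.2
  have hi' : (i' : ℝ) + 1 ≤ p := by exact_mod_cast i'.2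
  have : (0 : ℝ) ≤ (i : ℕ) := Nat.cast_nonneg _
  have : (0 : ℝ) ≤ (i' : ℕ) := Nat.cast_nonneg _
  obtain ⟨hx0, hx2⟩ := hx
  obtain ⟨hx0', hx2'⟩ := hx'
  obtain rfl : k = 0 := by
    have hlt : (k : ℝ) < 1 := by nlinarith
    have hgt : (-1 : ℝ) < k := by nlinarith
    have hlt' : k < 1 := by exact_mod_cast hlt
    have hgt' : -1 < k := by exact_mod_cast hgt
    omega
  rw [Int.cast_zero, mul_zero] at hturns
  obtain rfl : i = i' := Fin.ext (nat_eq_of_cast_lt_add_one (by linarith) (by linarith))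
  exact ⟨rfl, by linarith⟩

theorem polarPoint_inj {p : ℕ} {i i' : Fin p} {x x' r r' : ℝ} (hx : x ∈ Set.Ico (0 : ℝ) 2)
    (hx' : x' ∈ Set.Ico (0 : ℝ) 2) (hr : 0 < r) (hr' : 0 ≤ r')
    (h : polarPoint i x r = polarPoint i' x' r') : i = i' ∧ x = x' ∧ r = r' := by
  obtain ⟨hrr', hangle⟩ := eq_and_angle_eq_of_polar_eq hr hr' (congrArg (fun v : Plane => v 0) h)
    (congrArg (fun v : Plane => v 1) h)
  obtain ⟨hi, hxx'⟩ := sector_eq_of_angle_eq hx hx' hangle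
  exact ⟨hi, hxx', hrr'⟩

theorem polarPoint_two {p : ℕ} (i : Fin p) (r : ℝ) :
    polarPoint i 2 r = polarPoint (finRotate p i) 0 r := by
  obtain ⟨n, rfl⟩ : ∃ n, p = n + 1 := ⟨p - 1, by have := i.pos; omega⟩
  unfold polarPoint
  rw [coe_finRotate]
  split_ifs with hlast
  · have hturn : Real.pi * (2 * ((i : ℕ) : ℝ) + 2) / ((n + 1 : ℕ) : ℝ) = 0 + 2 * Real.pi := by
      rw [hlast, Fin.val_last]
      push_cast
      field_simp
      ring
    rw [hturn, Real.cos_add_two_pi, Real.sin_add_two_pi]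
    simp only [Nat.cast_zero, mul_zero, add_zero, zero_div]
  · push_cast
    ring_nf

theorem polarPoint_zero {p : ℕ} (i i' : Fin p) (x x' : ℝ) :
    polarPoint i x 0 = polarPoint i' x' 0 := by
  simp only [polarPoint, zero_mul]

theorem continuous_polarPoint {T : Type*} [TopologicalSpace T] {p : ℕ} (i : Fin p) {x r : T → ℝ}
    (hx : Continuous x) (hr : Continuous r) : Continuous fun t => polarPoint i (x t) (r t) := by
  refine (PiLp.continuous_toLp 2 _).comp (continuous_pi fun k => ?_)
  fin_cases k
  · change Continuous fun t => r t * Real.cos (Real.pi * (2 * i + x t) / p)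
    fun_prop
  · change Continuous fun t => r t * Real.sin (Real.pi * (2 * i + x t) / p)
    fun_prop

/-! ### The windmill is planar -/

namespace WindmillVertex

variable {p q : ℕ}

/-- The edges of the windmill as data, since curves cannot be defined by recursion on the
proposition `Step`. The bounds on the rows are stated in `ℝ`, where they are compared with the
coordinates of points. -/
inductive Rail (p q : ℕ) : Type
  | uv (i : Fin p)
  | vu (i : Fin p)
  | zu (i : Fin p)
  | zv (i : Fin p)
  | ua (i : Fin p) (h : (2 : ℝ) ≤ 2 * q)
  | vb (i : Fin p) (h : (2 : ℝ) ≤ 2 * q)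
  | uc (i : Fin p) (h : (2 : ℝ) ≤ 2 * q)
  | aa (i : Fin p) (j : ℕ) (h : (2 : ℝ) ≤ j) (h' : (j : ℝ) + 1 ≤ 2 * q)
  | bb (i : Fin p) (j : ℕ) (h : (2 : ℝ) ≤ j) (h' : (j : ℝ) + 1 ≤ 2 * q)
  | cc (i : Fin p) (j : ℕ) (h : (2 : ℝ) ≤ j) (h' : (j : ℝ) + 1 ≤ 2 * q)
  | ab (i : Fin p) (j : ℕ) (h : (2 : ℝ) ≤ j) (h' : (j : ℝ) ≤ 2 * q)
  | bc (i : Fin p) (j : ℕ) (h : (2 : ℝ) ≤ j) (h' : (j : ℝ) ≤ 2 * q)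
  | ac (i : Fin p) (h : (2 : ℝ) ≤ 2 * q)

namespace Rail

/-- The first end of an edge, where its curve starts. -/
def src : Rail p q → WindmillVertex p q
  | uv i => .u i
  | vu i => .v i
  | zu _ => .z
  | zv _ => .z
  | ua i _ => .u i
  | vb i _ => .v i
  | uc i _ => .u (finRotate p i)
  | aa i j _ _ => colA i j
  | bb i j _ _ => colB i j
  | cc i j _ _ => colC i j
  | ab i j _ _ => colA i j
  | bc i j _ _ => colB i j
  | ac i _ => colA i (2 * q)

/-- The second end of an edge, where its curve stops. -/
def tgt : Rail p q → WindmillVertex p q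
  | uv i => .v i
  | vu i => .u (finRotate p i)
  | zu i => .u i
  | zv i => .v i
  | ua i _ => colA i 2
  | vb i _ => colB i 2
  | uc i _ => colC i 2
  | aa i j _ _ => colA i (j + 1)
  | bb i j _ _ => colB i (j + 1)
  | cc i j _ _ => colC i (j + 1)
  | ab i j _ _ => colB i j
  | bc i j _ _ => colC i j
  | ac i _ => colC i (2 * q)

/-- The index of the sector in which an edge is drawn. -/
def idx : Rail p q → Fin p
  | uv i | vu i | zu i | zv i | ua i _ | vb i _ | uc i _ | aa i _ _ _ | bb i _ _ _ | cc i _ _ _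
  | ab i _ _ _ | bc i _ _ _ | ac i _ => i

/-- The angular coordinate along the curve of an edge, as in `polarPoint`. -/
noncomputable def ang : Rail p q → ℝ → ℝ
  | uv _, t => t
  | vu _, t => 1 + t
  | zu _, _ => 0
  | zv _, _ => 1
  | ua _ _, t => t / 2
  | vb _ _, _ => 1
  | uc _ _, t => 2 - t / 2
  | aa _ _ _ _, _ => 1 / 2
  | bb _ _ _ _, _ => 1
  | cc _ _ _ _, _ => 3 / 2
  | ab _ _ _ _, t => 1 / 2 + t / 2
  | bc _ _ _ _, t => 1 + t / 2
  | ac _ _, t => 1 / 2 + t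

/-- The radial coordinate along the curve of an edge. The middle path of a vane is shifted inwards
by `1 / 2`, so that the edge joining the ends of the outer two paths, drawn on a circle, avoids
it. -/
noncomputable def rad : Rail p q → ℝ → ℝ
  | uv _, _ => 1
  | vu _, _ => 1
  | zu _, t => t
  | zv _, t => t
  | ua _ _, t => 1 + t
  | vb _ _, t => 1 + t / 2
  | uc _ _, t => 1 + t
  | aa _ j _ _, t => j + t
  | bb _ j _ _, t => j - 1 / 2 + t
  | cc _ j _ _, t => j + t
  | ab _ j _ _, t => j - t / 2
  | bc _ j _ _, t => j - 1 / 2 + t / 2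
  | ac _ _, _ => 2 * q

/-- The curve along which an edge is drawn. -/
noncomputable def curve (e : Rail p q) (t : ℝ) : Plane :=
  polarPoint e.idx (e.ang t) (e.rad t)

theorem continuous_curve (e : Rail p q) : Continuous e.curve := by
  have hang : Continuous e.ang := by cases e <;> unfold ang <;> fun_prop
  have hrad : Continuous e.rad := by cases e <;> unfold rad <;> fun_prop
  exact continuous_polarPoint _ hang hrad

variable {e e' : Rail p q} {t t' : ℝ}

theorem ang_mem_Ico (ht : t ∈ Set.Ioo (0 : ℝ) 1) : e.ang t ∈ Set.Ico (0 : ℝ) 2 := by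
  obtain ⟨h0, h1⟩ := ht
  cases e <;> constructor <;> simp only [ang] <;> linarith

theorem rad_pos (ht : t ∈ Set.Ioo (0 : ℝ) 1) : 0 < e.rad t := by
  obtain ⟨h0, h1⟩ := ht
  cases e <;> simp only [rad] <;> linarith

theorem eq_of_coords_eq (ht : t ∈ Set.Ioo (0 : ℝ) 1) (ht' : t' ∈ Set.Ioo (0 : ℝ) 1)
    (hi : e.idx = e'.idx) (hx : e.ang t = e'.ang t') (hr : e.rad t = e'.rad t') :
    e = e' ∧ t = t' := by
  obtain ⟨h0, h1⟩ := ht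
  obtain ⟨h0', h1'⟩ := ht'
  cases e <;> cases e' <;> simp only [idx, ang, rad] at hi hx hr <;>
    first
    | (exfalso; linarith)
    | (subst hi; exact ⟨rfl, by linarith⟩)
    | (rename_i i j _ _ i' j' _ _
       obtain rfl : j = j' := nat_eq_of_cast_lt_add_one (by linarith) (by linarith)
       subst hi
       exact ⟨rfl, by linarith⟩)

theorem eq_of_curve_eq (ht : t ∈ Set.Ioo (0 : ℝ) 1) (ht' : t' ∈ Set.Ioo (0 : ℝ) 1)
    (h : e.curve t = e'.curve t') : e = e' ∧ t = t' := by
  obtain ⟨hi, hx, hr⟩ :=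
    polarPoint_inj (ang_mem_Ico ht) (ang_mem_Ico ht') (rad_pos ht) (rad_pos ht').le h
  exact eq_of_coords_eq ht ht' hi hx hr

end Rail

/-- The index of the sector in which a vertex is drawn; for `z` the choice is immaterial. -/
def idx (hp : 0 < p) : WindmillVertex p q → Fin p
  | z => ⟨0, hp⟩
  | u i | v i | a i _ | b i _ | c i _ => i

/-- The angular coordinate of a vertex, as in `polarPoint`. -/
noncomputable def ang : WindmillVertex p q → ℝ
  | z | u _ => 0
  | v _ | b _ _ => 1
  | a _ _ => 1 / 2
  | c _ _ => 3 / 2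

/-- The radial coordinate of a vertex. -/
noncomputable def rad : WindmillVertex p q → ℝ
  | z => 0
  | u _ | v _ => 1
  | a _ j | c _ j => (j : ℕ)
  | b _ j => (j : ℕ) - 1 / 2

/-- The position of a vertex in the plane. -/
noncomputable def position (hp : 0 < p) (w : WindmillVertex p q) : Plane :=
  polarPoint (w.idx hp) w.ang w.rad

theorem two_le_cast (j : Set.Icc 2 (2 * q)) : (2 : ℝ) ≤ (j : ℕ) := by
  exact_mod_cast j.2.1

theorem cast_le_two_mul (j : Set.Icc 2 (2 * q)) : ((j : ℕ) : ℝ) ≤ 2 * q := by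
  exact_mod_cast j.2.2

theorem ang_mem_Ico (w : WindmillVertex p q) : w.ang ∈ Set.Ico (0 : ℝ) 2 := by
  cases w <;> norm_num [ang]

theorem eq_z_or_one_le_rad (w : WindmillVertex p q) : w = z ∨ 1 ≤ w.rad := by
  cases w with
  | z => exact .inl rfl
  | u i | v i => exact .inr le_rfl
  | a i j | b i j | c i j =>
    have := two_le_cast j
    refine .inr ?_
    simp only [rad]
    linarith

theorem rad_nonneg (w : WindmillVertex p q) : 0 ≤ w.rad := by
  rcases w.eq_z_or_one_le_rad with rfl | h
  exacts [le_rfl, zero_le_one.trans h]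

theorem eq_of_coords_eq (hp : 0 < p) {w w' : WindmillVertex p q} (hi : w.idx hp = w'.idx hp)
    (hx : w.ang = w'.ang) (hr : w.rad = w'.rad) : w = w' := by
  cases w <;> cases w' <;> simp only [idx, ang, rad] at hi hx hr <;>
    first
    | rfl
    | (exfalso; linarith)
    | (subst hi; rfl)
    | (rename_i i j i' j'
       have hj : ((j : ℕ) : ℝ) = (j' : ℕ) := by linarith
       obtain rfl : j = j' := Subtype.ext (by exact_mod_cast hj)
       subst hi
       rfl)
    | (rename_i j
       have := two_le_cast j
       linarith)
    | (rename_i j _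
       have := two_le_cast j
       linarith)

theorem position_injective (hp : 0 < p) :
    Function.Injective (position hp : WindmillVertex p q → Plane) := by
  have eq_of_rad_pos {w w' : WindmillVertex p q} (hw : 0 < w.rad)
      (h : position hp w = position hp w') : w = w' := by
    obtain ⟨hi, hx, hr⟩ := polarPoint_inj w.ang_mem_Ico w'.ang_mem_Ico hw w'.rad_nonneg h
    exact eq_of_coords_eq hp hi hx hr
  intro w w' h
  rcases w.eq_z_or_one_le_rad with rfl | hw
  · rcases w'.eq_z_or_one_le_rad with rfl | hw'
    · rfl
    · exact (eq_of_rad_pos (zero_lt_one.trans_le hw') h.symm).symm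
  · exact eq_of_rad_pos (zero_lt_one.trans_le hw) h

theorem position_z (hp : 0 < p) (i : Fin p) (x : ℝ) :
    position hp (z : WindmillVertex p q) = polarPoint i x 0 :=
  polarPoint_zero ..

section Columns

variable (hp : 0 < p) (i : Fin p) {j : ℕ} (h : (2 : ℝ) ≤ j) (h' : (j : ℝ) ≤ 2 * q)
include h h'

theorem mem_Icc_of_cast : j ∈ Set.Icc 2 (2 * q) :=
  ⟨by exact_mod_cast h, by exact_mod_cast h'⟩

theorem position_colA :
    position hp (colA i j : WindmillVertex p q) = polarPoint i (1 / 2) j := by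
  simp only [column_of_mem (mem_Icc_of_cast h h')]
  rfl

theorem position_colB :
    position hp (colB i j : WindmillVertex p q) = polarPoint i 1 (j - 1 / 2) := by
  simp only [column_of_mem (mem_Icc_of_cast h h')]
  rfl

theorem position_colC :
    position hp (colC i j : WindmillVertex p q) = polarPoint i (3 / 2) j := by
  simp only [column_of_mem (mem_Icc_of_cast h h')]
  rfl

end Columns

namespace Rail

theorem curve_zero (hp : 0 < p) (e : Rail p q) : e.curve 0 = position hp e.src := by
  cases e <;> simp only [curve, idx, ang, rad, src, add_zero, sub_zero, zero_div]
  case uv | vu | ua | vb => rfl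
  case zu i | zv i => exact (position_z hp i _).symm
  case uc i _ => exact polarPoint_two i 1
  case aa i j h h' => exact (position_colA hp i h (by linarith)).symm
  case bb i j h h' => exact (position_colB hp i h (by linarith)).symm
  case cc i j h h' => exact (position_colC hp i h (by linarith)).symm
  case ab i j h h' => exact (position_colA hp i h h').symm
  case bc i j h h' => exact (position_colB hp i h h').symm
  case ac i h =>
    rw [position_colA hp i (by exact_mod_cast h) (by push_cast; rfl)]
    push_cast
    rfl

theorem curve_one (hp : 0 < p) (e : Rail p q) : e.curve 1 = position hp e.tgt := by
  cases e <;> simp only [curve, idx, ang, rad, tgt]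
  case uv | zu | zv => rfl
  case vu i => rw [one_add_one_eq_two, polarPoint_two]; rfl
  case ua i h => rw [position_colA hp i (j := 2) (by norm_num) (by exact_mod_cast h)]; norm_num
  case vb i h => rw [position_colB hp i (j := 2) (by norm_num) (by exact_mod_cast h)]; norm_num
  case uc i h => rw [position_colC hp i (j := 2) (by norm_num) (by exact_mod_cast h)]; norm_num
  case aa i j h h' =>
    rw [position_colA hp i (by push_cast; linarith) (by push_cast; exact h'), Nat.cast_add_one]
  case bb i j h h' =>
    rw [position_colB hp i (by push_cast; linarith) (by push_cast; exact h'), Nat.cast_add_one]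
    ring_nf
  case cc i j h h' =>
    rw [position_colC hp i (by push_cast; linarith) (by push_cast; exact h'), Nat.cast_add_one]
  case ab i j h h' => rw [position_colB hp i h h', add_halves]
  case bc i j h h' => rw [position_colC hp i h h']; ring_nf
  case ac i h =>
    rw [position_colC hp i (by exact_mod_cast h) (by push_cast; rfl)]
    push_cast
    ring_nf

theorem curve_ne_position (hp : 0 < p) {e : Rail p q} {t : ℝ} (ht : t ∈ Set.Ioo (0 : ℝ) 1)
    (w : WindmillVertex p q) : e.curve t ≠ position hp w := by
  intro h
  obtain ⟨-, hx, hr⟩ := polarPoint_inj (ang_mem_Ico ht) w.ang_mem_Ico (rad_pos ht) w.rad_nonneg h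
  obtain ⟨h0, h1⟩ := ht
  have not_between {j j' : ℕ} (h : (j : ℝ) < j') (h' : (j' : ℝ) < j + 1) : False :=
    h.ne' (congrArg _ (nat_eq_of_cast_lt_add_one h' (by linarith)))
  cases w with
  | a i j | b i j | c i j =>
    have := two_le_cast j
    have := cast_le_two_mul j
    cases e <;> simp only [ang, rad, WindmillVertex.ang, WindmillVertex.rad] at hx hr <;>
      first
      | linarith
      | (rename_i j' _ _
         exact not_between (j := j') (j' := j) (by linarith) (by linarith))
  | _ =>
    cases e <;> simp only [ang, rad, WindmillVertex.ang, WindmillVertex.rad] at hx hr <;> linarith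

theorem exists_of_step {x y : WindmillVertex p q} (h : Step x y) :
    ∃ e : Rail p q, e.src = x ∧ e.tgt = y := by
  cases h with
  | uv i => exact ⟨.uv i, rfl, rfl⟩
  | vu i => exact ⟨.vu i, rfl, rfl⟩
  | zu i => exact ⟨.zu i, rfl, rfl⟩
  | zv i => exact ⟨.zv i, rfl, rfl⟩
  | ua i h => exact ⟨.ua i (by exact_mod_cast h.2), rfl, column_of_mem h⟩
  | vb i h => exact ⟨.vb i (by exact_mod_cast h.2), rfl, column_of_mem h⟩
  | uc i h => exact ⟨.uc i (by exact_mod_cast h.2), rfl, column_of_mem h⟩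
  | aa i j h h' =>
    exact ⟨.aa i j (by exact_mod_cast h.1) (by exact_mod_cast h'.2), column_of_mem h,
      column_of_mem h'⟩
  | bb i j h h' =>
    exact ⟨.bb i j (by exact_mod_cast h.1) (by exact_mod_cast h'.2), column_of_mem h,
      column_of_mem h'⟩
  | cc i j h h' =>
    exact ⟨.cc i j (by exact_mod_cast h.1) (by exact_mod_cast h'.2), column_of_mem h,
      column_of_mem h'⟩
  | ab i j =>
    exact ⟨.ab i j (two_le_cast j) (cast_le_two_mul j), column_of_mem j.2, column_of_mem j.2⟩
  | bc i j =>
    exact ⟨.bc i j (two_le_cast j) (cast_le_two_mul j), column_of_mem j.2, column_of_mem j.2⟩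
  | ac i j h =>
    obtain ⟨j, hj⟩ := j
    obtain rfl : j = 2 * q := h
    exact ⟨.ac i (by exact_mod_cast hj.1), column_of_mem hj, column_of_mem hj⟩

end Rail

theorem nonempty_planeEmbedding (hp : 0 < p) : Nonempty (PlaneEmbedding (windmillGraph p q)) := by
  have exists_of_adj : ∀ x y, (windmillGraph p q).Adj x y →
      ∃ e : Rail p q, s(e.src, e.tgt) = s(x, y) := by
    refine fun x y => adj_induction (P := fun x y => ∃ e : Rail p q, s(e.src, e.tgt) = s(x, y)) ?_
    intro x y h
    obtain ⟨e, rfl, rfl⟩ := Rail.exists_of_step h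
    exact ⟨⟨e, rfl⟩, ⟨e, Sym2.eq_swap⟩⟩
  exact CurveDrawing.nonempty_planeEmbedding
    { point := position hp
      src := Rail.src
      tgt := Rail.tgt
      curve := Rail.curve
      point_injective := position_injective hp
      continuous_curve := Rail.continuous_curve
      curve_zero := Rail.curve_zero hp
      curve_one := Rail.curve_one hp
      exists_of_adj := exists_of_adj
      curve_ne_point := fun _ _ => Rail.curve_ne_position hp
      eq_of_curve_eq := fun _ _ _ ht _ => Rail.eq_of_curve_eq ht }

end WindmillVertex

/-! ### The theorem -/

theorem HasRootedK2Minor.mono {V : Type*} {G : SimpleGraph V} {R : Set V} {s t : ℕ} (hst : s ≤ t)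
    (h : HasRootedK2Minor G R t) : HasRootedK2Minor G R s := by
  obtain ⟨M, hM, hR⟩ := h
  have hinj : Function.Injective (Sum.map (id : Fin 2 → Fin 2) (Fin.castLE hst)) :=
    Function.injective_id.sumMap (Fin.castLE_injective hst)
  refine ⟨M ∘ Sum.map id (Fin.castLE hst), ⟨fun w => hM.connected _,
    fun x y hxy => hM.disjoint _ _ (hinj.ne hxy), fun x y hxy => hM.edge _ _ ?_⟩,
    fun j => hR (Fin.castLE hst j)⟩
  simpa only [completeBipartiteGraph_adj, Sum.isLeft_map, Sum.isRight_map] using hxy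

theorem exists_even_le_le_succ {t : ℕ} {n : ℕ} (hn : Even n) (ht : n ≤ t) :
    ∃ s, n ≤ s ∧ Even s ∧ s ≤ t ∧ t ≤ s + 1 := by
  rcases Nat.even_or_odd t with h | ⟨k, rfl⟩
  · exact ⟨t, ht, h, le_rfl, t.le_succ⟩
  · obtain ⟨m, rfl⟩ := hn
    exact ⟨2 * k, by omega, even_two_mul k, (2 * k).le_succ, le_rfl⟩

theorem mainTheorem4 :
    -- the windmill graphs
    (∀ t : ℕ, 6 ≤ t → Even t →
      (windmill t).IsVertexConnected 3 ∧ Nonempty (PlaneEmbedding (windmill t)) ∧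
        ¬ HasRootedK2Minor (windmill t) (windmillRoots t) t) ∧
    -- every face cover, in every plane embedding, has quadratic size
    (∃ c : ℝ, 0 < c ∧ ∀ t : ℕ, 6 ≤ t → Even t →
      ∀ (E : PlaneEmbedding (windmill t)) (C : Finset (Set Plane)),
        E.IsFaceCover (windmillRoots t) C → c * (t : ℝ) ^ 2 ≤ (C.card : ℝ)) ∧
    -- every valid bound on the size of a face cover is at least quadratic
    (∀ f : ℕ → ℕ,
      (∀ t : ℕ, 1 ≤ t → ∀ (V : Type) [Finite V] (G : SimpleGraph V) (R : Set V)
        (E : PlaneEmbedding G), G.IsVertexConnected 3 → ¬ HasRootedK2Minor G R t →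
          ∃ C : Finset (Set Plane), E.IsFaceCover R C ∧ C.card ≤ f t) →
      ∃ c : ℝ, 0 < c ∧ ∀ t : ℕ, 6 ≤ t → c * (t : ℝ) ^ 2 ≤ (f t : ℝ)) := by
  have windmill_properties (t : ℕ) (ht : 6 ≤ t) (hev : Even t) :
      (windmill t).IsVertexConnected 3 ∧ Nonempty (PlaneEmbedding (windmill t)) ∧
        ¬ HasRootedK2Minor (windmill t) (windmillRoots t) t :=
    ⟨WindmillVertex.isVertexConnected_windmillGraph (by omega),
      WindmillVertex.nonempty_planeEmbedding (by omega), not_hasRootedK2Minor_windmill ht hev⟩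
  refine ⟨windmill_properties, ⟨1 / 100, by norm_num, fun t ht hev E C hC =>
    sq_le_card_of_isFaceCover_windmillRoots ht hev E hC⟩, fun f hf => ⟨1 / 200, by norm_num, ?_⟩⟩
  intro t ht
  obtain ⟨s, hs, hev, hst, hts⟩ := exists_even_le_le_succ (by decide : Even 6) ht
  obtain ⟨hconn, ⟨E⟩, hminor⟩ := windmill_properties s hs hev
  obtain ⟨C, hC, hCf⟩ := hf t (by omega) _ _ (windmillRoots s) E hconn
    fun h => hminor (h.mono hst)
  have hs' : (6 : ℝ) ≤ s := by exact_mod_cast hs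
  have hts' : (t : ℝ) ≤ s + 1 := by exact_mod_cast hts
  calc (1 / 200 : ℝ) * (t : ℝ) ^ 2 ≤ 1 / 200 * ((s : ℝ) + 1) ^ 2 := by gcongr
    _ ≤ 1 / 100 * (s : ℝ) ^ 2 := by nlinarith
    _ ≤ C.card := sq_le_card_of_isFaceCover_windmillRoots hs hev E hC
    _ ≤ f t := by exact_mod_cast hCf
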